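/- For $n\in\mathbb{Z}$ put $f=-n^2$, $g=n^3-1$, $$\lambda=\frac{f^3+g^3+1}{fg}=-n^4+3n \quad\text{(a polynomial identity in } n\text{)},$$ $$a=3(f^2+g^2-fg)-\lambda(f+g)=n^7+2n^6+3n^5-n^4-3n^3-3n^2+3n+3,$$ and let $$B_n(X)=X^3+aX^2+\lambda X-1 .$$ Let $K(B_n)$ be the splitting field of $B_n$ over $\mathbb{Q}$, let $\mathcal{O}$ be its ring of integers, and let $\theta_1\neq\theta_2$ be any two distinct roots of $B_n$ in $K(B_n)$. Theorem. (i) Let $n\in\mathbb{Z}$ with $n\neq-1$, and suppose that the integer $3a+\lambda^2=(n^4-3n+3)(n^4+3n^3+6n^2+6n+3)$ is squarefree. Then $\theta_1,\theta_2$ are units of $\mathcal{O}$, and $-1,\theta_1,\theta_2$ generate the full unit group $\mathcal{O}^\times$. (ii) The exclusion of $n=-1$ is necessary: for $n=-1$ the integer $3a+\lambda^2=7$ is squarefree, but $\theta_1,\theta_2$ are units of $\mathcal{O}$ which together with $-1$ generate a subgroup of index exactly $3$ in $\mathcal{O}^\times$. -/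

import Mathlib

open Polynomial NumberField

namespace UnitFamily

/-- The parameter `f = -n²`. -/
def f (n : ℤ) : ℤ := -n ^ 2

/-- The parameter `g = n³ - 1`. -/
def g (n : ℤ) : ℤ := n ^ 3 - 1

/-- The coefficient `λ = (f³ + g³ + 1) / (f g)`, a polynomial in `n`. -/
def lam (n : ℤ) : ℤ := -n ^ 4 + 3 * n

/-- The coefficient `a = 3 (f² + g² - f g) - λ (f + g)`. -/
def a (n : ℤ) : ℤ :=
  3 * (f n ^ 2 + g n ^ 2 - f n * g n) - lam n * (f n + g n)

theorem lam_spec (n : ℤ) : lam n * (f n * g n) = f n ^ 3 + g n ^ 3 + 1 := by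
  simp only [lam, f, g]; ring

theorem a_eq (n : ℤ) :
    a n = n ^ 7 + 2 * n ^ 6 + 3 * n ^ 5 - n ^ 4 - 3 * n ^ 3 - 3 * n ^ 2 + 3 * n + 3 := by
  simp only [a, lam, f, g]; ring

theorem three_a_add_lam_sq (n : ℤ) :
    3 * a n + lam n ^ 2 =
      (n ^ 4 - 3 * n + 3) * (n ^ 4 + 3 * n ^ 3 + 6 * n ^ 2 + 6 * n + 3) := by
  rw [a_eq]; simp only [lam]; ring

/-- The cubic `B_n = X³ + a X² + λ X - 1`, with rational coefficients. -/
noncomputable def B (n : ℤ) : ℚ[X] :=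
  X ^ 3 + C (a n : ℚ) * X ^ 2 + C (lam n : ℚ) * X - 1

end UnitFamily

/-! Write `m = 3 a + λ²`. The splitting field `K` is a real cyclic cubic field with Galois group
generated by some `σ`. It is also generated by the roots `y₁, y₂, y₃` of a homogenised simplest
cubic with parameters `r, s` satisfying `r² + 3rs + 9s² = m`, and the roots of `B n` are integral
affine combinations of consecutive `yᵢ`.

On the units, `X² + XY + Y²` with `X = log|u|`, `Y = log|σ u|` is a quadratic form for which the
powers of `u` and `σ u` form a hexagonal lattice, a copy of the Eisenstein integers. Three facts
carry part (i). Lower bound: as `m` is squarefree and prime to 3, `m` divides the product of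
differences of the conjugates of every integer of `K` (`ShanksTriple.dvd_prod_sub`). A unit other
than `±1` therefore has size at least `c = log²(m/2) / 4` (`sq_log_le_of_le_abs_prod_sub`). Upper
bound: one root of `B n` is close to `-a` and the other two are small, so a root `θ` has size below
`3c` (`log_form_lt_of_squarefree`). Covering: modulo powers of `θ` and `σ θ`, any unit can be
brought to size at most a third of that of `θ`, hence below `c`, hence to `±1`
(`exists_eq_zpow_mul_zpow`). Dirichlet's unit theorem is not needed.

For `n = -1` the upper bound holds for `y₁` instead, so `y₁` and its conjugates generate, while a
root of `B (-1)` is a quotient of two conjugates of `y₁`. This is multiplication by an Eisenstein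
integer of norm 3, whence the index 3. -/

namespace UnitFamily

/-! ### Covering radius of the hexagonal lattice -/

theorem exists_int_hexagonal_close (s t : ℝ) :
    ∃ a b : ℤ, (s - a) ^ 2 - (s - a) * (t - b) + (t - b) ^ 2 ≤ 1 / 3 := by
  -- The region around a lattice point: twice the form is `β (2β + γ) + γ (β + 2γ) ≤ β + γ`, and the
  -- two constraints add up to `β + γ ≤ 2/3`.
  have key : ∀ β γ : ℝ, 0 ≤ β → 0 ≤ γ → 2 * β + γ ≤ 1 → β + 2 * γ ≤ 1 →
      β ^ 2 + β * γ + γ ^ 2 ≤ 1 / 3 := by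
    intro β γ hβ hγ h1 h2
    nlinarith [mul_nonneg hβ hγ, mul_nonneg hβ (sub_nonneg.2 h1), mul_nonneg hγ (sub_nonneg.2 h2),
      mul_nonneg hγ (sub_nonneg.2 h1), mul_nonneg hβ (sub_nonneg.2 h2)]
  have hs0 := Int.fract_nonneg s
  have hs1 := (Int.fract_lt_one s).le
  have ht0 := Int.fract_nonneg t
  have ht1 := (Int.fract_lt_one t).le
  have hs := Int.self_sub_floor s
  have ht := Int.self_sub_floor t
  set p := Int.fract s
  set q := Int.fract t
  have fin : ∀ i j : ℤ, (p - i) ^ 2 - (p - i) * (q - j) + (q - j) ^ 2 ≤ 1 / 3 →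
      ∃ a b : ℤ, (s - a) ^ 2 - (s - a) * (t - b) + (t - b) ^ 2 ≤ 1 / 3 := by
    intro i j h
    refine ⟨⌊s⌋ + i, ⌊t⌋ + j, ?_⟩
    push_cast
    rw [← sub_sub, ← sub_sub, hs, ht]
    exact h
  -- The unit square is cut into regions, each carried by a symmetry of the lattice fixing a
  -- suitable corner into the region of `key`.
  rcases le_total q p with h | h
  · rcases le_total (2 * p - q) 1 with h1 | h1
    · rcases le_total (p + q) 1 with h2 | h2
      · have := key (p - q) q (by linarith) ht0 (by linarith) (by linarith)
        exact fin 0 0 (by push_cast; linarith)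
      · have := key (1 - p) (p - q) (by linarith) (by linarith) (by linarith) (by linarith)
        exact fin 1 1 (by push_cast; linarith)
    · rcases le_total (2 * q) p with h2 | h2
      · have := key (1 - p) q (by linarith) (by linarith) (by linarith) (by linarith)
        exact fin 1 0 (by push_cast; linarith)
      · have := key (1 - p) (p - q) (by linarith) (by linarith) (by linarith) (by linarith)
        exact fin 1 1 (by push_cast; linarith)
  · rcases le_total (2 * q - p) 1 with h1 | h1
    · rcases le_total (p + q) 1 with h2 | h2
      · have := key (q - p) p (by linarith) hs0 (by linarith) (by linarith)
        exact fin 0 0 (by push_cast; linarith)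
      · have := key (1 - q) (q - p) (by linarith) (by linarith) (by linarith) (by linarith)
        exact fin 1 1 (by push_cast; linarith)
    · rcases le_total (2 * p) q with h2 | h2
      · have := key (1 - q) p (by linarith) (by linarith) (by linarith) (by linarith)
        exact fin 0 1 (by push_cast; linarith)
      · have := key (1 - q) (q - p) (by linarith) (by linarith) (by linarith) (by linarith)
        exact fin 1 1 (by push_cast; linarith)

/-! ### Lower bound for the size of a unit with large product of differences -/

theorem one_sub_mul_one_sub_mul_le_two {u v : ℝ} (hu : |u| ≤ 1) (hv : |v| ≤ 1) :
    (1 - u) * (1 - v) * (1 - u * v) ≤ 2 := by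
  obtain ⟨hu1, hu2⟩ := abs_le.1 hu
  obtain ⟨hv1, hv2⟩ := abs_le.1 hv
  have huv : |u * v| ≤ 1 := by
    rw [abs_mul]; exact mul_le_one₀ hu (abs_nonneg _) hv
  obtain ⟨h1, h2⟩ := abs_le.1 huv
  have mixed : ∀ {p q : ℝ}, 0 ≤ p → p ≤ 1 → -1 ≤ q → q ≤ 0 →
      (1 - p) * (1 - q) * (1 - p * q) ≤ 2 := by
    intro p q hp hp1 hq hq0
    -- Here `1 - q ≤ 2` and `1 - p q ≤ 1 + p`; the remaining factor gives `2 (1 - p²) ≤ 2`.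
    have e1 : (1 - q) * (1 - p * q) ≤ 2 * (1 + p) := by
      apply mul_le_mul (by linarith) (by nlinarith) (by nlinarith) (by norm_num)
    have : (1 - p) * ((1 - q) * (1 - p * q)) ≤ (1 - p) * (2 * (1 + p)) :=
      mul_le_mul_of_nonneg_left e1 (by linarith)
    nlinarith
  rcases le_total 0 u with hu0 | hu0 <;> rcases le_total 0 v with hv0 | hv0
  · have : (1 - u) * (1 - v) ≤ 1 := mul_le_one₀ (by linarith) (by linarith) (by linarith)
    have : (1 - u) * (1 - v) * (1 - u * v) ≤ 1 :=
      mul_le_one₀ this (by linarith) (by nlinarith)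
    linarith
  · exact mixed hu0 hu2 hv1 hv0
  · have := mixed hv0 hv2 hu1 hu0
    linarith
  -- Adding this nonnegative product to the left side gives `2 (1 + uv)(1 - uv) = 2 (1 - u²v²)`.
  · have : 0 ≤ (1 + u) * (1 + v) * (1 - u * v) := by
      refine mul_nonneg (mul_nonneg ?_ ?_) ?_ <;> linarith
    nlinarith [sq_nonneg (u * v)]

/-- The product factors as `-x² y (1 - u)(1 - v)(1 - uv)` with `u = y/x` and `v = z/y`, both of
absolute value at most 1. -/
theorem abs_prod_sub_le {x y z : ℝ} (hy : y ≠ 0) (hyx : |y| ≤ |x|) (hzy : |z| ≤ |y|) :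
    |(x - y) * (y - z) * (z - x)| ≤ 2 * (|x| ^ 2 * |y|) := by
  have hx : x ≠ 0 := by
    rintro rfl
    rw [abs_zero] at hyx
    exact hy (abs_eq_zero.1 (le_antisymm hyx (abs_nonneg _)))
  have hu : |y / x| ≤ 1 := by
    rw [abs_div]; exact div_le_one_of_le₀ hyx (abs_nonneg _)
  have hv : |z / y| ≤ 1 := by
    rw [abs_div]; exact div_le_one_of_le₀ hzy (abs_nonneg _)
  have key := one_sub_mul_one_sub_mul_le_two hu hv
  have h0 : 0 ≤ (1 - y / x) * (1 - z / y) * (1 - y / x * (z / y)) := by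
    have huv : |y / x * (z / y)| ≤ 1 := by
      rw [abs_mul]; exact mul_le_one₀ hu (abs_nonneg _) hv
    have := (abs_le.1 hu).2
    have := (abs_le.1 hv).2
    have := (abs_le.1 huv).2
    refine mul_nonneg (mul_nonneg ?_ ?_) ?_ <;> linarith
  have e : (x - y) * (y - z) * (z - x)
      = -(x ^ 2 * y * ((1 - y / x) * (1 - z / y) * (1 - y / x * (z / y)))) := by
    field_simp; ring
  rw [e, abs_neg, abs_mul, abs_mul, abs_pow, abs_of_nonneg h0]
  have : 0 ≤ |x| ^ 2 * |y| := by positivity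
  nlinarith

theorem sq_log_le_of_le_abs_prod_sub_aux {x y z m : ℝ} (h : |x * y * z| = 1) (hm : 2 ≤ m)
    (hδ : m ≤ |(x - y) * (y - z) * (z - x)|) (hyx : |y| ≤ |x|) (hzy : |z| ≤ |y|) :
    Real.log (m / 2) ^ 2 / 4 ≤
      Real.log |x| ^ 2 + Real.log |x| * Real.log |y| + Real.log |y| ^ 2 := by
  have hne : x * y * z ≠ 0 := by intro h0; rw [h0, abs_zero] at h; norm_num at h
  have hx : x ≠ 0 := by rintro rfl; simp at hne
  have hy : y ≠ 0 := by rintro rfl; simp at hne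
  have h1 := hδ.trans (abs_prod_sub_le hy hyx hzy)
  have hxp : 0 < |x| := abs_pos.2 hx
  have hyp : 0 < |y| := abs_pos.2 hy
  have h2 : Real.log (m / 2) ≤ 2 * Real.log |x| + Real.log |y| := by
    have : Real.log (m / 2) ≤ Real.log (|x| ^ 2 * |y|) :=
      Real.log_le_log (by linarith) (by linarith)
    rwa [Real.log_mul (by positivity) hyp.ne', Real.log_pow, Nat.cast_ofNat] at this
  have h3 : 0 ≤ Real.log (m / 2) := Real.log_nonneg (by linarith)
  -- `4 (X² + XY + Y²) = (2X + Y)² + 3Y²`.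
  nlinarith [sq_nonneg (Real.log |y|)]

/-- A unit of a totally real cubic field whose conjugates have large discriminant has a large
logarithmic norm. -/
theorem sq_log_le_of_le_abs_prod_sub {x y z m : ℝ} (h : |x * y * z| = 1) (hm : 2 ≤ m)
    (hδ : m ≤ |(x - y) * (y - z) * (z - x)|) :
    Real.log (m / 2) ^ 2 / 4 ≤
      Real.log |x| ^ 2 + Real.log |x| * Real.log |y| + Real.log |y| ^ 2 := by
  have hne : x * y * z ≠ 0 := by intro h0; rw [h0, abs_zero] at h; norm_num at h
  have hx : x ≠ 0 := by rintro rfl; simp at hne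
  have hy : y ≠ 0 := by rintro rfl; simp at hne
  have hz : z ≠ 0 := by rintro rfl; simp at hne
  have hs : Real.log |x| + Real.log |y| + Real.log |z| = 0 := by
    rw [← Real.log_mul (abs_ne_zero.2 hx) (abs_ne_zero.2 hy), ← abs_mul,
      ← Real.log_mul (abs_ne_zero.2 (mul_ne_zero hx hy)) (abs_ne_zero.2 hz), ← abs_mul, h,
      Real.log_one]
  -- As the logarithms sum to zero, the form takes the same value on any two of them, so the
  -- variables may be sorted by absolute value.
  have hz' : Real.log |z| = -Real.log |x| - Real.log |y| := by linarith
  have fin : ∀ {p q w : ℝ}, |p * q * w| = |x * y * z| →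
      |(p - q) * (q - w) * (w - p)| = |(x - y) * (y - z) * (z - x)| →
      |q| ≤ |p| → |w| ≤ |q| → Real.log (m / 2) ^ 2 / 4 ≤
        Real.log |p| ^ 2 + Real.log |p| * Real.log |q| + Real.log |q| ^ 2 := by
    intro p q w h1 h2 h3 h4
    exact sq_log_le_of_le_abs_prod_sub_aux (h1.trans h) hm (h2 ▸ hδ) h3 h4
  have odd : ∀ {p q : ℝ}, p = -q → |p| = |q| := by rintro p q rfl; exact abs_neg q
  rcases le_total |y| |x| with h1 | h1 <;> rcases le_total |z| |y| with h2 | h2 <;>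
    rcases le_total |z| |x| with h3 | h3
  · exact fin rfl rfl h1 h2
  · exact fin rfl rfl h1 h2
  · have := fin (p := x) (q := z) (w := y) (by ring_nf) (odd (by ring)) h3 h2
    rw [hz'] at this; linarith
  · have := fin (p := z) (q := x) (w := y) (by ring_nf) (by ring_nf) h3 h1
    rw [hz'] at this; linarith
  · have := fin (p := y) (q := x) (w := z) (by ring_nf) (odd (by ring)) h1 h3
    linarith
  · have := fin (p := y) (q := z) (w := x) (by ring_nf) (by ring_nf) h2 h3
    rw [hz'] at this; linarith
  · have := fin (p := z) (q := y) (w := x) (by ring_nf) (odd (by ring)) h2 h1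
    rw [hz'] at this; linarith
  · have := fin (p := z) (q := y) (w := x) (by ring_nf) (odd (by ring)) h2 h1
    rw [hz'] at this; linarith

/-! ### Units as an Eisenstein lattice -/

section LogLattice

variable {G : Type*} [CommGroup G] [HasDistribNeg G] (σ : G →* G) (x : Additive G →+ ℝ)

/-- The quadratic form on a group with an automorphism of order three induced by a logarithm. -/
noncomputable def logNorm (u : G) : ℝ :=
  x (.ofMul u) ^ 2 + x (.ofMul u) * x (.ofMul (σ u)) + x (.ofMul (σ u)) ^ 2

/-- If small elements are trivial, an element of small norm generates with its conjugate. -/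
theorem exists_eq_zpow_mul_zpow {x : Additive G →+ ℝ} {σ : G →* G}
    (hx : ∀ u, x (.ofMul u) + x (.ofMul (σ u)) + x (.ofMul (σ (σ u))) = 0) {c : ℝ}
    (hc : ∀ u, logNorm σ x u < c → u = 1 ∨ u = -1) {θ : G} (hθ : 0 < logNorm σ x θ)
    (hθc : logNorm σ x θ < 3 * c) (u : G) :
    ∃ a b : ℤ, u = θ ^ a * σ θ ^ b ∨ u = -(θ ^ a * σ θ ^ b) := by
  set p := x (.ofMul θ) with hp
  set q := x (.ofMul (σ θ)) with hq
  set P := x (.ofMul u) with hP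
  set Q := x (.ofMul (σ u)) with hQ
  have hθ' : x (.ofMul (σ (σ θ))) = -p - q := by linarith [hx θ]
  have hN : logNorm σ x θ = p ^ 2 + p * q + q ^ 2 := rfl
  set N := p ^ 2 + p * q + q ^ 2
  have hN0 : N ≠ 0 := by rw [← hN]; exact hθ.ne'
  -- These are the real coordinates of `(P, Q)` in the basis `(p, q)`, `(q, -p - q)` coming from `θ`
  -- and `σ θ`; in them the form is `N (s² - st + t²)`.
  obtain ⟨a, b, hab⟩ := exists_int_hexagonal_close ((P * (p + q) + Q * q) / N) ((P * q - Q * p) / N)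
  refine ⟨a, b, ?_⟩
  have key : logNorm σ x (u * (θ ^ a * σ θ ^ b)⁻¹) < c := by
    have e : logNorm σ x (u * (θ ^ a * σ θ ^ b)⁻¹) =
        N * (((P * (p + q) + Q * q) / N - a) ^ 2
          - ((P * (p + q) + Q * q) / N - a) * ((P * q - Q * p) / N - b)
          + ((P * q - Q * p) / N - b) ^ 2) := by
      simp only [logNorm, map_mul, map_inv, map_zpow, ofMul_mul, ofMul_inv, ofMul_zpow, map_add,
        map_neg, map_zsmul, hθ', zsmul_eq_mul, ← hp, ← hq, ← hP, ← hQ]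
      field_simp
      simp only [N]
      ring
    rw [e]
    have : N * (1 / 3) < c := by rw [← hN]; linarith
    exact (mul_le_mul_of_nonneg_left hab (hN ▸ hθ.le)).trans_lt this
  rcases hc _ key with h | h
  · left; exact mul_inv_eq_one.1 h
  · right; rw [mul_inv_eq_iff_eq_mul] at h; rw [h, neg_one_mul]

theorem closure_eq_top_of_logNorm_lt {x : Additive G →+ ℝ} {σ : G →* G}
    (hx : ∀ u, x (.ofMul u) + x (.ofMul (σ u)) + x (.ofMul (σ (σ u))) = 0) {c : ℝ}
    (hc : ∀ u, logNorm σ x u < c → u = 1 ∨ u = -1) {θ : G} (hθ : 0 < logNorm σ x θ)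
    (hθc : logNorm σ x θ < 3 * c) : Subgroup.closure {-1, θ, σ θ} = ⊤ := by
  rw [eq_top_iff]
  intro u _
  have h1 : (-1 : G) ∈ Subgroup.closure {-1, θ, σ θ} := Subgroup.subset_closure (by simp)
  have h2 : θ ∈ Subgroup.closure {-1, θ, σ θ} := Subgroup.subset_closure (by simp)
  have h3 : σ θ ∈ Subgroup.closure {-1, θ, σ θ} := Subgroup.subset_closure (by simp)
  obtain ⟨a, b, h | h⟩ := exists_eq_zpow_mul_zpow hx hc hθ hθc u
  · rw [h]; exact mul_mem (zpow_mem h2 a) (zpow_mem h3 b)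
  · rw [h, ← neg_one_mul (_ * _)]; exact mul_mem h1 (mul_mem (zpow_mem h2 a) (zpow_mem h3 b))

end LogLattice

/-! ### Upper bound for the size of a root -/

/-- With `κ = log(m / 2M)` one has `κ + X ≤ log(m/2)` and `4 (X² + XY + Y²) = 3X² + (2Y + X)²`. It
is thus enough that `(2Y + X)² ≤ 6κX`, the cross term of `3 (κ + X)²`; the strict inequality comes
from `3κ²`. -/
theorem log_form_lt_of_dominant {x y z L m M A : ℝ} (h2 : x * y + y * z + z * x = L)
    (h3 : x * y * z = 1) (hA : A ≤ |x|) (hM : |x| ≤ M) (hA1 : 1 ≤ A)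
    (hb : ((|L| + 1) / A) ^ 2 + 2 / A ≤ 1) (hc : (|L| + 1) ^ 2 / A + 2 ≤ (m / (2 * M)) ^ 6)
    (hm : 2 * M < m) :
    4 * (Real.log |x| ^ 2 + Real.log |x| * Real.log |y| + Real.log |y| ^ 2) <
      3 * Real.log (m / 2) ^ 2 := by
  have hx : x ≠ 0 := by rintro rfl; simp at h3
  have hy : y ≠ 0 := by rintro rfl; simp at h3
  have hz : z ≠ 0 := by rintro rfl; simp at h3
  have hxp : 0 < |x| := abs_pos.2 hx
  have hx1 : 1 ≤ |x| := hA1.trans hA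
  have hMp : 0 < M := hxp.trans_le hM
  have hyz : |y * z| = 1 / |x| := by
    rw [eq_div_iff hxp.ne', ← abs_mul, show y * z * x = 1 by linarith, abs_one]
  have hyz1 : |y * z| ≤ 1 := by rw [hyz]; exact div_le_one_of_le₀ hx1 (abs_nonneg _)
  have hsum : |y + z| ≤ (|L| + 1) / |x| := by
    rw [le_div_iff₀ hxp, ← abs_mul, show (y + z) * x = L - y * z by linarith]
    exact (abs_sub _ _).trans (by linarith)
  have hsq : y ^ 2 + z ^ 2 ≤ ((|L| + 1) / |x|) ^ 2 + 2 / |x| := by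
    have e1 : (y + z) ^ 2 ≤ ((|L| + 1) / |x|) ^ 2 := by
      rw [← sq_abs]; exact pow_le_pow_left₀ (abs_nonneg _) hsum 2
    have e2 : -(y * z) ≤ 1 / |x| := by rw [← hyz]; exact neg_le_abs _
    have e3 : 2 / |x| = 2 * (1 / |x|) := by ring
    nlinarith
  have hle1 : y ^ 2 + z ^ 2 ≤ 1 := by
    refine hsq.trans (le_trans ?_ hb)
    gcongr
  have hle2 : (y ^ 2 + z ^ 2) * |x| ≤ (m / (2 * M)) ^ 6 := by
    calc (y ^ 2 + z ^ 2) * |x| ≤ (((|L| + 1) / |x|) ^ 2 + 2 / |x|) * |x| := by gcongr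
      _ = (|L| + 1) ^ 2 / |x| + 2 := by field_simp
      _ ≤ (|L| + 1) ^ 2 / A + 2 := by gcongr
      _ ≤ _ := hc
  have hs : Real.log |x| + Real.log |y| + Real.log |z| = 0 := by
    rw [← Real.log_mul (abs_ne_zero.2 hx) (abs_ne_zero.2 hy), ← abs_mul,
      ← Real.log_mul (abs_ne_zero.2 (mul_ne_zero hx hy)) (abs_ne_zero.2 hz), ← abs_mul, h3,
      abs_one, Real.log_one]
  have hX : 0 ≤ Real.log |x| := Real.log_nonneg hx1
  have hmp : 0 < m := by linarith
  have hκ : 0 < Real.log (m / (2 * M)) := Real.log_pos (by rw [lt_div_iff₀ (by linarith)]; linarith)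
  have hW : Real.log (m / (2 * M)) + Real.log |x| ≤ Real.log (m / 2) := by
    rw [← Real.log_mul (by positivity) hxp.ne']
    apply Real.log_le_log (by positivity)
    calc m / (2 * M) * |x| ≤ m / (2 * M) * M := by gcongr
      _ = m / 2 := by field_simp
  have small : ∀ w : ℝ, w ≠ 0 → w ^ 2 ≤ y ^ 2 + z ^ 2 →
      Real.log |w| ≤ 0 ∧ 2 * Real.log |w| + Real.log |x| ≤ 6 * Real.log (m / (2 * M)) := by
    intro w hw hwle
    have hwp := abs_pos.2 hw
    constructor
    · apply Real.log_nonpos hwp.le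
      rw [← sq_le_one_iff₀ hwp.le, sq_abs]
      exact hwle.trans hle1
    · have : Real.log (|w| ^ 2 * |x|) ≤ Real.log ((m / (2 * M)) ^ 6) := by
        apply Real.log_le_log (by positivity)
        rw [sq_abs]
        exact le_trans (by gcongr) hle2
      rwa [Real.log_mul (by positivity) hxp.ne', Real.log_pow, Real.log_pow] at this
  obtain ⟨hy1, hy2⟩ := small y hy (by nlinarith [sq_nonneg z])
  obtain ⟨hz1, hz2⟩ := small z hz (by nlinarith [sq_nonneg y])
  set X := Real.log |x|
  set Y := Real.log |y|
  set Z := Real.log |z|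
  set κ := Real.log (m / (2 * M))
  -- Since `X + Y + Z = 0`, also `2Y + X = -(2Z + X)`. The bounds on `y` and `z` give `|2Y + X| ≤
  -- 6κ`, and `Y, Z ≤ 0` gives `|2Y + X| ≤ X`.
  have hD : (2 * Y + X) ^ 2 ≤ 6 * κ * X := by
    rw [← sq_abs, sq]
    apply mul_le_mul _ _ (abs_nonneg _) (by linarith)
    · rw [abs_le]; constructor <;> linarith
    · rw [abs_le]; constructor <;> linarith
  have hWsq : (κ + X) ^ 2 ≤ Real.log (m / 2) ^ 2 := pow_le_pow_left₀ (by linarith) hW 2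
  nlinarith [sq_nonneg κ, mul_pos hκ hκ]

/-- The upper bound for the logarithmic norm, from a localisation of the largest root. -/
theorem log_form_lt {x y z a L m M A : ℝ} (h1 : x + y + z = -a)
    (h2 : x * y + y * z + z * x = L) (h3 : x * y * z = 1)
    (hAM : ∀ x y z : ℝ, x + y + z = -a → x * y + y * z + z * x = L → x * y * z = 1 →
      |y| ≤ |x| → |z| ≤ |x| → A ≤ |x| ∧ |x| ≤ M)
    (hA1 : 1 ≤ A)
    (hb : ((|L| + 1) / A) ^ 2 + 2 / A ≤ 1) (hc : (|L| + 1) ^ 2 / A + 2 ≤ (m / (2 * M)) ^ 6)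
    (hm : 2 * M < m) :
    Real.log |x| ^ 2 + Real.log |x| * Real.log |y| + Real.log |y| ^ 2 <
      3 * (Real.log (m / 2) ^ 2 / 4) := by
  have hx : x ≠ 0 := by rintro rfl; simp at h3
  have hy : y ≠ 0 := by rintro rfl; simp at h3
  have hz : z ≠ 0 := by rintro rfl; simp at h3
  have hs : Real.log |x| + Real.log |y| + Real.log |z| = 0 := by
    rw [← Real.log_mul (abs_ne_zero.2 hx) (abs_ne_zero.2 hy), ← abs_mul,
      ← Real.log_mul (abs_ne_zero.2 (mul_ne_zero hx hy)) (abs_ne_zero.2 hz), ← abs_mul, h3,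
      abs_one, Real.log_one]
  have hz' : Real.log |z| = -Real.log |x| - Real.log |y| := by linarith
  have fin : ∀ p q w : ℝ, p + q + w = -a → p * q + q * w + w * p = L → p * q * w = 1 →
      |q| ≤ |p| → |w| ≤ |p| →
      4 * (Real.log |p| ^ 2 + Real.log |p| * Real.log |q| + Real.log |q| ^ 2) <
      3 * Real.log (m / 2) ^ 2 := by
    intro p q w e1 e2 e3 hq hw
    obtain ⟨k1, k2⟩ := hAM p q w e1 e2 e3 hq hw
    exact log_form_lt_of_dominant e2 e3 k1 k2 hA1 hb hc hm
  by_cases hyx : |y| ≤ |x|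
  · by_cases hzx : |z| ≤ |x|
    · have := fin x y z h1 h2 h3 hyx hzx
      linarith
    · have := fin z x y (by linarith) (by linarith) (by linarith) (not_le.1 hzx).le
        (hyx.trans (not_le.1 hzx).le)
      rw [hz'] at this
      linarith
  · by_cases hzy : |z| ≤ |y|
    · have := fin y x z (by linarith) (by linarith) (by linarith) (not_le.1 hyx).le hzy
      linarith
    · have := fin z x y (by linarith) (by linarith) (by linarith)
        ((not_le.1 hyx).le.trans (not_le.1 hzy).le) (not_le.1 hzy).le
      rw [hz'] at this
      linarith

/-- From `x (y + z) = L - yz` and `|yz| = 1/|x| ≤ 1`, the largest root differs from `-a` by at most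
`(|L| + 1) / |x|`. -/
theorem dominant_root_bounds {a L x y z : ℝ} (h1 : x + y + z = -a)
    (h2 : x * y + y * z + z * x = L) (h3 : x * y * z = 1) (hy : |y| ≤ |x|) (hz : |z| ≤ |x|) :
    1 ≤ |x| ∧ |a| ≤ 3 * |x| ∧ |x| * (|a| - |x|) ≤ |L| + 1 ∧ |x| * (|x| - |a|) ≤ |L| + 1 := by
  have hx : x ≠ 0 := by rintro rfl; simp at h3
  have hxp : 0 < |x| := abs_pos.2 hx
  have h3' : |x| * |y| * |z| = 1 := by rw [← abs_mul, ← abs_mul, h3, abs_one]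
  have hx1 : 1 ≤ |x| := by
    by_contra! hlt
    have : |x| * |y| * |z| < 1 := by
      have h0 : |x| * |y| < 1 := by nlinarith [abs_nonneg y]
      have := abs_nonneg y
      nlinarith [abs_nonneg z, mul_nonneg hxp.le this]
    linarith
  have hyz : |y * z| = 1 / |x| := by
    rw [eq_div_iff hxp.ne', abs_mul]; linarith
  have hyz1 : |y * z| ≤ 1 := by rw [hyz]; exact div_le_one_of_le₀ hx1 (abs_nonneg _)
  have hsum : |x| * |y + z| ≤ |L| + 1 := by
    rw [← abs_mul, show x * (y + z) = L - y * z by linarith]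
    exact (abs_sub _ _).trans (by linarith)
  have e1 : |a| ≤ |x| + |y + z| := by
    rw [← abs_neg a, ← h1, add_assoc]; exact abs_add_le _ _
  have e2 : |x| ≤ |a| + |y + z| := by
    rw [show x = -a - (y + z) by linarith, ← abs_neg a]; exact abs_sub _ _
  refine ⟨hx1, ?_, ?_, ?_⟩
  · have := abs_add_le y z
    linarith
  · nlinarith
  · nlinarith

theorem log_form_lt_of_large {x y z a L m : ℝ} (h1 : x + y + z = -a)
    (h2 : x * y + y * z + z * x = L) (h3 : x * y * z = 1) (ha : 9 ≤ |a|)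
    (hL : 3 * (|L| + 1) ≤ |a|)
    (hc : (|L| + 1) ^ 2 / (|a| - 1) + 2 ≤ (m / (2 * (|a| + 1))) ^ 6)
    (hm : 2 * (|a| + 1) < m) :
    Real.log |x| ^ 2 + Real.log |x| * Real.log |y| + Real.log |y| ^ 2 <
      3 * (Real.log (m / 2) ^ 2 / 4) := by
  refine log_form_lt h1 h2 h3 ?_ (by linarith) ?_ hc hm
  · intro x y z h1 h2 h3 hy hz
    obtain ⟨k1, k2, k3, k4⟩ := dominant_root_bounds h1 h2 h3 hy hz
    constructor
    · by_contra! h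
      nlinarith
    · by_contra! h
      nlinarith
  · have hp : 0 < |a| - 1 := by linarith
    have e1 : (|L| + 1) / (|a| - 1) ≤ 1 / 2 := by
      rw [div_le_iff₀ hp]; linarith
    have e2 : 2 / (|a| - 1) ≤ 1 / 4 := by
      rw [div_le_iff₀ hp]; linarith
    have e3 : 0 ≤ (|L| + 1) / (|a| - 1) := by positivity
    nlinarith

theorem log_form_lt_of_one {x y z : ℝ} (h1 : x + y + z = -5)
    (h2 : x * y + y * z + z * x = 2) (h3 : x * y * z = 1) :
    Real.log |x| ^ 2 + Real.log |x| * Real.log |y| + Real.log |y| ^ 2 <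
      3 * (Real.log (19 / 2) ^ 2 / 4) := by
  -- Here `|a| = 5` is too small for the bounds `|a| ± 1`: the condition `((|L| + 1)/A)² + 2/A ≤ 1`
  -- fails for `A = 4`. The endpoints `5 ± 0.7` still follow from `|x| · ||x| - 5| ≤ 3`.
  refine log_form_lt (A := 43 / 10) (M := 57 / 10) h1 h2 h3 ?_ (by norm_num)
    (by norm_num) (by norm_num) (by norm_num)
  intro x y z h1 h2 h3 hy hz
  obtain ⟨k1, k2, k3, k4⟩ := dominant_root_bounds h1 h2 h3 hy hz
  rw [show |(5 : ℝ)| = 5 by norm_num] at *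
  rw [show |(2 : ℝ)| = 2 by norm_num] at *
  constructor
  · by_contra! h
    nlinarith
  · by_contra! h
    nlinarith

/-! ### The upper bound for all admissible parameters -/

/-- If `3 ∣ n`, both factors of `m` are divisible by 3. -/
theorem not_three_dvd_of_squarefree {n : ℤ} (hsf : Squarefree (3 * a n + lam n ^ 2)) :
    ¬ (3 : ℤ) ∣ n := by
  rintro ⟨k, rfl⟩
  have : (3 : ℤ) * 3 ∣ 3 * a (3 * k) + lam (3 * k) ^ 2 := by
    rw [three_a_add_lam_sq]
    exact mul_dvd_mul ⟨27 * k ^ 4 - 3 * k + 1, by ring⟩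
      ⟨27 * k ^ 4 + 27 * k ^ 3 + 18 * k ^ 2 + 6 * k + 1, by ring⟩
  have := hsf 3 this
  rw [Int.isUnit_iff] at this
  omega

theorem cases_of_squarefree {n : ℤ} (hn : n ≠ -1)
    (hsf : Squarefree (3 * a n + lam n ^ 2)) : n = 1 ∨ n = 2 ∨ 4 ≤ n ∨ n ≤ -4 := by
  have h3 := not_three_dvd_of_squarefree hsf
  have h2 : n ≠ -2 := by
    rintro rfl
    have : (5 : ℤ) * 5 ∣ 3 * a (-2) + lam (-2) ^ 2 := by
      rw [three_a_add_lam_sq]; norm_num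
    have := hsf 5 this
    rw [Int.isUnit_iff] at this
    omega
  omega

theorem log_form_lt_of_poly {x y z n a L m : ℝ} (h1 : x + y + z = -a)
    (h2 : x * y + y * z + z * x = L) (h3 : x * y * z = 1) (hn : 4 ≤ |n|) (ha : 9 ≤ |a|)
    (hL : 3 * (|L| + 1) ≤ |a|) (hm : 3 * |n| * (|a| + 1) ≤ 4 * m)
    (hLa : 5 * (|L| + 1) ^ 2 ≤ (14 * |n| - 10) * (|a| - 1)) :
    Real.log |x| ^ 2 + Real.log |x| * Real.log |y| + Real.log |y| ^ 2 <
      3 * (Real.log (m / 2) ^ 2 / 4) := by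
  have hpos : 0 < |a| - 1 := by linarith
  have hc : 3 * |n| / 8 ≤ m / (2 * (|a| + 1)) := by
    rw [le_div_iff₀ (by linarith)]; linarith
  refine log_form_lt_of_large h1 h2 h3 ha hL ?_ (by nlinarith)
  calc (|L| + 1) ^ 2 / (|a| - 1) + 2 ≤ 14 / 5 * |n| := by
        rw [← le_sub_iff_add_le, div_le_iff₀ hpos]; linarith
    _ ≤ (3 * |n| / 8) ^ 6 := by
        -- Five of the six factors are at least `3/2`, and `(3/2)⁵ · 3/8 > 14/5`.
        have e : (3 / 2 : ℝ) ^ 5 ≤ (3 * |n| / 8) ^ 5 :=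
          pow_le_pow_left₀ (by norm_num) (by linarith) 5
        rw [pow_succ]
        norm_num at e
        nlinarith
    _ ≤ _ := by gcongr

theorem log_form_lt_of_squarefree {n : ℤ} (hn : n ≠ -1)
    (hsf : Squarefree (3 * a n + lam n ^ 2)) {x y z : ℝ} (h1 : x + y + z = -(a n : ℝ))
    (h2 : x * y + y * z + z * x = lam n) (h3 : x * y * z = 1) :
    Real.log |x| ^ 2 + Real.log |x| * Real.log |y| + Real.log |y| ^ 2 <
      3 * (Real.log (((3 * a n + lam n ^ 2 : ℤ) : ℝ) / 2) ^ 2 / 4) := by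
  rcases cases_of_squarefree hn hsf with rfl | rfl | h | h
  · have e1 : a 1 = 5 := by rw [a_eq]; norm_num
    have e2 : lam 1 = 2 := by simp [lam]
    rw [e1] at h1 ⊢
    rw [e2] at h2 ⊢
    have := log_form_lt_of_one (by push_cast at h1; exact h1) (by push_cast at h2; exact h2) h3
    norm_num at this ⊢
    exact this
  · have e1 : a 2 = 309 := by rw [a_eq]; norm_num
    have e2 : lam 2 = -10 := by simp [lam]
    rw [e1] at h1 ⊢
    rw [e2] at h2 ⊢
    refine log_form_lt_of_large h1 h2 h3 ?_ ?_ ?_ ?_ <;> norm_num [abs_of_pos]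
  -- After expansion in `k ≥ 0` each required inequality has nonnegative coefficients. The
  -- substitution `n = -4 - k` does the same on the negative side.
  · obtain ⟨k, rfl⟩ : ∃ k : ℤ, n = 4 + k := ⟨n - 4, by ring⟩
    have hk : (0 : ℝ) ≤ k := by exact_mod_cast (by omega : (0 : ℤ) ≤ k)
    rw [three_a_add_lam_sq]
    have hn' : |((4 + k : ℤ) : ℝ)| = 4 + k := by
      rw [abs_of_nonneg] <;> push_cast <;> linarith
    have ha : |(a (4 + k) : ℝ)| = a (4 + k) := by
      apply abs_of_nonneg
      rw [a_eq]; push_cast; ring_nf; positivity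
    have hl : |(lam (4 + k) : ℝ)| = -lam (4 + k) := by
      apply abs_of_nonpos
      rw [← neg_nonneg, lam]; push_cast; ring_nf; positivity
    refine log_form_lt_of_poly (n := (4 + k : ℤ)) h1 h2 h3 (by rw [hn']; linarith) ?_ ?_ ?_ ?_ <;>
      rw [ha] <;> (try rw [hl]) <;> (try rw [hn']) <;> rw [← sub_nonneg, a_eq] <;>
      (try simp only [lam]) <;> push_cast <;> ring_nf <;> positivity
  · obtain ⟨k, rfl⟩ : ∃ k : ℤ, n = -4 - k := ⟨-4 - n, by ring⟩
    have hk : (0 : ℝ) ≤ k := by exact_mod_cast (by omega : (0 : ℤ) ≤ k)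
    rw [three_a_add_lam_sq]
    have hn' : |((-4 - k : ℤ) : ℝ)| = 4 + k := by
      rw [abs_of_nonpos] <;> push_cast <;> linarith
    have ha : |(a (-4 - k) : ℝ)| = -a (-4 - k) := by
      apply abs_of_nonpos
      rw [← neg_nonneg, a_eq]; push_cast; ring_nf; positivity
    have hl : |(lam (-4 - k) : ℝ)| = -lam (-4 - k) := by
      apply abs_of_nonpos
      rw [← neg_nonneg, lam]; push_cast; ring_nf; positivity
    refine log_form_lt_of_poly (n := (-4 - k : ℤ)) h1 h2 h3 (by rw [hn']; linarith) ?_ ?_ ?_ ?_ <;>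
      rw [ha] <;> (try rw [hl]) <;> (try rw [hn']) <;> rw [← sub_nonneg, a_eq] <;>
      (try simp only [lam]) <;> push_cast <;> ring_nf <;> positivity

/-! ### Simplest cubics -/

/-- Three elements permuted cyclically by `y ↦ (y² - (r + s) y - 2 s²) / s` which are the roots of
the homogenised simplest cubic `Y³ - r Y² - (r + 3 s) s Y - s³`. -/
structure ShanksTriple {R : Type*} [CommRing R] (r s : ℤ) (y₁ y₂ y₃ : R) : Prop where
  sum : y₁ + y₂ + y₃ = r
  sum_mul : y₁ * y₂ + y₂ * y₃ + y₃ * y₁ = -((r + 3 * s) * s)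
  prod : y₁ * y₂ * y₃ = s ^ 3
  next₁ : s * y₂ = y₁ ^ 2 - (r + s) * y₁ - 2 * s ^ 2
  next₂ : s * y₃ = y₂ ^ 2 - (r + s) * y₂ - 2 * s ^ 2
  next₃ : s * y₁ = y₃ ^ 2 - (r + s) * y₃ - 2 * s ^ 2

namespace ShanksTriple

section Ring

variable {R S : Type*} [CommRing R] [CommRing S] {r s : ℤ} {y₁ y₂ y₃ : R}

theorem rotate (h : ShanksTriple r s y₁ y₂ y₃) : ShanksTriple r s y₂ y₃ y₁ :=
  ⟨by linear_combination h.sum, by linear_combination h.sum_mul, by linear_combination h.prod,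
    h.next₂, h.next₃, h.next₁⟩

theorem of_map {φ : R →+* S} (hφ : Function.Injective φ)
    (h : ShanksTriple r s (φ y₁) (φ y₂) (φ y₃)) : ShanksTriple r s y₁ y₂ y₃ := by
  constructor <;> apply hφ <;> simp only [map_add, map_mul, map_sub, map_neg, map_pow,
    map_intCast, map_ofNat]
  exacts [h.sum, h.sum_mul, h.prod, h.next₁, h.next₂, h.next₃]

theorem root (h : ShanksTriple r s y₁ y₂ y₃) :
    y₁ ^ 3 - r * y₁ ^ 2 - (r + 3 * s) * s * y₁ - s ^ 3 = 0 := by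
  linear_combination y₁ ^ 2 * h.sum - y₁ * h.sum_mul + h.prod

theorem eq_or_eq_or_eq [IsDomain R] (h : ShanksTriple r s y₁ y₂ y₃) {x : R}
    (hx : x ^ 3 - r * x ^ 2 - (r + 3 * s) * s * x - s ^ 3 = 0) : x = y₁ ∨ x = y₂ ∨ x = y₃ := by
  have : (x - y₁) * ((x - y₂) * (x - y₃)) = 0 := by
    linear_combination hx - x ^ 2 * h.sum + x * h.sum_mul - h.prod
  simpa [sub_eq_zero] using this

/-- This cyclic sum is not symmetric in the roots; the `next` relations, which orient the triple,
decide its value and so the sign of the product of differences. -/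
theorem sum_sq_mul (h : ShanksTriple r s y₁ y₂ y₃) :
    y₁ ^ 2 * y₂ + y₂ ^ 2 * y₃ + y₃ ^ 2 * y₁ = 3 * s ^ 3 := by
  linear_combination (-y₂) * h.next₁ - y₃ * h.next₂ - y₁ * h.next₃ +
    (s * (y₁ + y₂ + y₃ + r) + 2 * s ^ 2) * h.sum + (r - s) * h.sum_mul

end Ring

end ShanksTriple

theorem exists_root_cubic (p q w : ℝ) : ∃ x : ℝ, x ^ 3 + p * x ^ 2 + q * x + w = 0 := by
  set M : ℝ := 1 + |p| + |q| + |w| with hM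
  have hp := abs_le.1 (le_refl |p|)
  have hq := abs_le.1 (le_refl |q|)
  have hw := abs_le.1 (le_refl |w|)
  have hp0 := abs_nonneg p
  have hq0 := abs_nonneg q
  have hw0 := abs_nonneg w
  have hM1 : 1 ≤ M := by linarith
  have hM2 : M ≤ M ^ 2 := by nlinarith
  have b1 : |p| * M ^ 2 + |q| * M + |w| ≤ (M - 1) * M ^ 2 := by
    have : |q| * M ≤ |q| * M ^ 2 := by gcongr
    have : |w| * 1 ≤ |w| * M ^ 2 := by gcongr; linarith
    nlinarith
  have cont : Continuous fun x : ℝ => x ^ 3 + p * x ^ 2 + q * x + w := by fun_prop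
  have h0 : (0 : ℝ) ∈ Set.Icc ((-M) ^ 3 + p * (-M) ^ 2 + q * (-M) + w)
      (M ^ 3 + p * M ^ 2 + q * M + w) := by
    have a1 : p * M ^ 2 ≤ |p| * M ^ 2 := by gcongr; exact hp.2
    have a2 : -|p| * M ^ 2 ≤ p * M ^ 2 := by gcongr; exact hp.1
    have a3 : q * M ≤ |q| * M := by gcongr; exact hq.2
    have a4 : -|q| * M ≤ q * M := by gcongr; exact hq.1
    constructor <;> nlinarith
  obtain ⟨x, _, hx⟩ := intermediate_value_Icc (by linarith) cont.continuousOn h0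
  exact ⟨x, hx⟩

/-- One real root suffices: the second is given by the `next` formula, a polynomial in the first
divided by `s`, and the third by the trace. -/
theorem exists_real_shanksTriple (r : ℤ) {s : ℤ} (hs : s ≠ 0) :
    ∃ y₁ y₂ y₃ : ℝ, ShanksTriple r s y₁ y₂ y₃ := by
  obtain ⟨y, hy⟩ := exists_root_cubic (-r) (-((r + 3 * s) * s)) (-s ^ 3)
  have hs' : (s : ℝ) ≠ 0 := by exact_mod_cast hs
  obtain ⟨y₂, h1⟩ : ∃ y₂ : ℝ, s * y₂ = y ^ 2 - (r + s) * y - 2 * s ^ 2 :=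
    ⟨(y ^ 2 - (r + s) * y - 2 * s ^ 2) / s, by field_simp⟩
  have h2 : y * y₂ + y₂ * (r - y - y₂) + (r - y - y₂) * y = -((r + 3 * s) * s) := by
    apply mul_left_cancel₀ (pow_ne_zero 2 hs')
    grind
  have h3 : y * y₂ * (r - y - y₂) = s ^ 3 := by linear_combination hy + y * h2
  refine ⟨y, y₂, r - y - y₂, by ring, h2, h3, h1, ?_, ?_⟩
  · grind
  · grind

/-! ### Divisibility of products of differences by the conductor -/

namespace ShanksTriple

section Different

variable {R : Type*} [CommRing R] {r s : ℤ} {y₁ y₂ y₃ : R}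

/-- The cube of a translate of a root is divisible by the conductor. -/
theorem dvd_cube (h : ShanksTriple r s y₁ y₂ y₃) :
    ((r ^ 2 + 3 * r * s + 9 * s ^ 2 : ℤ) : R) ∣ (3 * y₁ - r) ^ 3 := by
  refine ⟨3 * (3 * y₁ - r) + (2 * r + 3 * s), ?_⟩
  push_cast
  linear_combination 27 * h.root

/-- The product of differences of an integral combination `A y + B σ y`. -/
theorem prod_sub_combination (h : ShanksTriple r s y₁ y₂ y₃) (A B : R) :
    (A * (y₁ - y₂) + B * (y₂ - y₃)) * (A * (y₂ - y₃) + B * (y₃ - y₁)) *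
        (A * (y₃ - y₁) + B * (y₁ - y₂)) =
      ((r ^ 2 + 3 * r * s + 9 * s ^ 2 : ℤ) : R) *
        (-(A ^ 3 + B ^ 3) * s + A ^ 2 * B * (r + 3 * s) - A * B ^ 2 * r) := by
  obtain ⟨h1, h2, h3, -, -, -⟩ := id h
  have h4 := h.sum_sq_mul
  have hy3 : y₃ = r - y₁ - y₂ := by linear_combination h1
  have k1 : (y₁ - y₂) * (y₂ - y₃) * (y₃ - y₁) =
      -(((r ^ 2 + 3 * r * s + 9 * s ^ 2 : ℤ) : R) * s) := by
    push_cast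
    linear_combination (y₁ * y₂ + y₂ * y₃ + y₃ * y₁) * h1 + r * h2 - 3 * h3 - 2 * h4
  have k2 : (y₁ - y₂) ^ 2 * (y₂ - y₃) + (y₂ - y₃) ^ 2 * (y₃ - y₁) + (y₃ - y₁) ^ 2 * (y₁ - y₂) =
      ((r ^ 2 + 3 * r * s + 9 * s ^ 2 : ℤ) : R) * (r + 3 * s) := by
    push_cast
    subst hy3
    grind
  have k3 : (y₁ - y₂) ^ 2 * (y₃ - y₁) + (y₂ - y₃) ^ 2 * (y₁ - y₂) + (y₃ - y₁) ^ 2 * (y₂ - y₃) =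
      -(((r ^ 2 + 3 * r * s + 9 * s ^ 2 : ℤ) : R) * r) := by
    linear_combination -3 * k1 - k2
  linear_combination (A ^ 3 + B ^ 3) * k1 + A ^ 2 * B * k2 + A * B ^ 2 * k3

variable [IsDomain R] [CharZero R] {σ : R →+* R}

theorem dvd_of_intCast_dvd (hfix : ∀ x, σ x = x → ∃ k : ℤ, x = k) {m l : ℤ} (hm : m ≠ 0)
    (h : (m : R) ∣ (l : R)) : m ∣ l := by
  obtain ⟨w, hw⟩ := h
  have hm' : (m : R) ≠ 0 := by exact_mod_cast hm
  have : (m : R) * σ w = m * w := by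
    rw [← hw]
    have := congrArg σ hw
    rw [map_mul, map_intCast, map_intCast] at this
    exact this.symm
  obtain ⟨k, rfl⟩ := hfix w (mul_left_cancel₀ hm' this)
  exact ⟨k, by exact_mod_cast hw⟩

/-- By `dvd_cube` each `3 yᵢ - r` lies in the radical of `(m)`, hence so does the trace, which is a
rational integer. For squarefree `m`, a rational integer in that radical is a multiple of `m`. -/
theorem dvd_trace_mul (h : ShanksTriple r s y₁ y₂ y₃)
    (hfix : ∀ x, σ x = x → ∃ k : ℤ, x = k) (h₁ : σ y₁ = y₂) (h₂ : σ y₂ = y₃) (h₃ : σ y₃ = y₁)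
    (hsf : Squarefree (r ^ 2 + 3 * r * s + 9 * s ^ 2)) {ε : R} (hε : σ (σ (σ ε)) = ε) :
    ∃ p : ℤ, ε * (3 * y₁ - r) + σ ε * (3 * y₂ - r) + σ (σ ε) * (3 * y₃ - r) =
      ((r ^ 2 + 3 * r * s + 9 * s ^ 2 : ℤ) : R) * p := by
  set m : ℤ := r ^ 2 + 3 * r * s + 9 * s ^ 2 with hm
  obtain ⟨t, ht⟩ := hfix (ε * (3 * y₁ - r) + σ ε * (3 * y₂ - r) + σ (σ ε) * (3 * y₃ - r)) (by
    simp only [map_add, map_mul, map_sub, map_ofNat, map_intCast, h₁, h₂, h₃, hε]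
    ring)
  have mem : ∀ {x z : R}, (m : R) ∣ z ^ 3 → x * z ∈ (Ideal.span {(m : R)}).radical := by
    intro x z hz
    exact Ideal.mul_mem_left _ _ ⟨3, Ideal.mem_span_singleton.2 hz⟩
  have hrad : (t : R) ∈ (Ideal.span {(m : R)}).radical := by
    rw [← ht]
    exact add_mem (add_mem (mem h.dvd_cube) (mem h.rotate.dvd_cube)) (mem h.rotate.rotate.dvd_cube)
  obtain ⟨k, hk⟩ := hrad
  rw [Ideal.mem_span_singleton, ← Int.cast_pow] at hk
  obtain ⟨p, hp⟩ := hsf.isRadical k t (dvd_of_intCast_dvd hfix hsf.ne_zero hk)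
  exact ⟨p, by rw [ht, hp]; push_cast; ring⟩

/-- The product of differences of the conjugates of any element is divisible by the conductor. -/
theorem dvd_prod_sub (h : ShanksTriple r s y₁ y₂ y₃)
    (hfix : ∀ x, σ x = x → ∃ k : ℤ, x = k) (h₁ : σ y₁ = y₂) (h₂ : σ y₂ = y₃) (h₃ : σ y₃ = y₁)
    (hsf : Squarefree (r ^ 2 + 3 * r * s + 9 * s ^ 2))
    (h3m : IsCoprime (r ^ 2 + 3 * r * s + 9 * s ^ 2) 3) {ε : R} (hε : σ (σ (σ ε)) = ε) :
    ∃ k : ℤ, (ε - σ ε) * (σ ε - σ (σ ε)) * (σ (σ ε) - ε) =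
      (((r ^ 2 + 3 * r * s + 9 * s ^ 2) * k : ℤ) : R) := by
  obtain ⟨p, hp⟩ := h.dvd_trace_mul hfix h₁ h₂ h₃ hsf hε
  obtain ⟨q, hq⟩ := h.rotate.dvd_trace_mul hfix h₂ h₃ h₁ hsf hε
  obtain ⟨t, ht⟩ := hfix (ε + σ ε + σ (σ ε)) (by simp only [map_add, hε]; ring)
  obtain ⟨d, hd⟩ := hfix ((ε - σ ε) * (σ ε - σ (σ ε)) * (σ (σ ε) - ε)) (by
    simp only [map_mul, map_sub, hε]; ring)
  set m : ℤ := r ^ 2 + 3 * r * s + 9 * s ^ 2 with hm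
  have hmR : (m : R) = r ^ 2 + 3 * r * s + 9 * s ^ 2 := by rw [hm]; push_cast; ring
  have hm0 : (9 * m : R) ≠ 0 :=
    mul_ne_zero (by norm_num) (by exact_mod_cast hsf.ne_zero)
  obtain ⟨s1, s2, -, -, -, -⟩ := id h
  set a := ε
  set b := σ ε
  set c := σ (σ ε)
  -- Expansion of `ε` in `1, z₁, z₂` with `zᵢ = 3 yᵢ - r`. The `zᵢ` have trace 0, with `Tr(z₁²) =
  -- 6m` and `Tr(z₁ z₂) = -3m`, so `m` cancels from the traces `mp` and `mq` and only the
  -- denominator 9 is left.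
  have key : 9 * ε = 3 * t + (2 * p + q) * (3 * y₁ - r) + (p + 2 * q) * (3 * y₂ - r) := by
    apply mul_left_cancel₀ hm0
    have hc : c = t - a - b := by linear_combination ht
    have hy3 : y₃ = r - y₁ - y₂ := by linear_combination s1
    rw [hmR] at hp hq ⊢
    rw [hc, hy3] at hp
    rw [hc, hy3] at hq
    rw [hy3] at s2
    grind
  have key2 := congrArg σ key
  have key3 := congrArg σ key2
  simp only [map_mul, map_add, map_sub, map_ofNat, map_intCast, h₁, h₂, h₃] at key2 key3
  have hcomb := h.prod_sub_combination (2 * p + q) (p + 2 * q)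
  have e1 : 3 * (a - b) = (2 * p + q) * (y₁ - y₂) + (p + 2 * q) * (y₂ - y₃) := by
    apply mul_left_cancel₀ (show (3 : R) ≠ 0 by norm_num)
    linear_combination key - key2
  have e2 : 3 * (b - c) = (2 * p + q) * (y₂ - y₃) + (p + 2 * q) * (y₃ - y₁) := by
    apply mul_left_cancel₀ (show (3 : R) ≠ 0 by norm_num)
    linear_combination key2 - key3
  have e3 : 3 * (c - a) = (2 * p + q) * (y₃ - y₁) + (p + 2 * q) * (y₁ - y₂) := by
    linear_combination -e1 - e2
  rw [← e1, ← e2, ← e3] at hcomb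
  -- The differences of conjugates of `3ε` are integral combinations of those of the `yᵢ`, so
  -- `prod_sub_combination` applies; the factor `3³` is prime to `m`.
  have hdvd : m ∣ d * 3 ^ 3 := by
    refine ⟨-((2 * p + q) ^ 3 + (p + 2 * q) ^ 3) * s + (2 * p + q) ^ 2 * (p + 2 * q) * (r + 3 * s)
      - (2 * p + q) * (p + 2 * q) ^ 2 * r, ?_⟩
    have e4 : (d : R) * 3 ^ 3 = 3 * (a - b) * (3 * (b - c)) * (3 * (c - a)) := by
      rw [← hd]; ring
    rw [hcomb] at e4
    exact_mod_cast e4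
  obtain ⟨k, rfl⟩ := (h3m.pow_right (n := 3)).dvd_of_dvd_mul_right hdvd
  exact ⟨k, hd⟩

end Different

end ShanksTriple

/-! ### The roots of `B n` in terms of a simplest cubic -/

/-- First parameter of the simplest cubic defining the splitting field of `B n`. -/
def shanksR (n : ℤ) : ℤ := n ^ 4 + 3 * n ^ 3 - 3 * n - 3

/-- Second parameter of the simplest cubic defining the splitting field of `B n`. -/
def shanksS (n : ℤ) : ℤ := -(n ^ 3 + n ^ 2 - 1)

/-- The translation in the expression of the roots of `B n`. -/
def shift (n : ℤ) : ℤ := -2 * n ^ 5 - n ^ 4 + 2 * n ^ 2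

/-- The root of `B n` attached to two consecutive roots of the simplest cubic. -/
def theta {R : Type*} [CommRing R] (n : ℤ) (y y' : R) : R := shift n - g n * y - f n * y'

theorem shanksS_ne_zero (n : ℤ) : shanksS n ≠ 0 := by
  intro h
  have h1 : n * (n * (n + 1)) = 1 := by simp only [shanksS] at h; linarith
  rcases Int.isUnit_iff.1 (IsUnit.of_mul_eq_one _ h1) with rfl | rfl <;> norm_num at h1

theorem three_a_add_lam_sq_eq (n : ℤ) : 3 * a n + lam n ^ 2 =
    shanksR n ^ 2 + 3 * shanksR n * shanksS n + 9 * shanksS n ^ 2 := by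
  rw [three_a_add_lam_sq]; simp only [shanksR, shanksS]; ring

theorem f_sq_sub_mul_add_g_sq_ne_zero (n : ℤ) : f n ^ 2 - f n * g n + g n ^ 2 ≠ 0 := by
  intro h
  have h1 : f n ^ 2 = 0 := by nlinarith [sq_nonneg (2 * g n - f n), sq_nonneg (f n)]
  have h2 : n = 0 := by simpa [f] using h1
  subst h2
  simp [f, g] at h

theorem isIntegral_of_cubic {R : Type*} [CommRing R] {p q w : ℤ} {x : R}
    (h : x ^ 3 + p * x ^ 2 + q * x + w = 0) : IsIntegral ℤ x := by
  refine ⟨X ^ 3 + C p * X ^ 2 + C q * X + C w, by monicity!, ?_⟩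
  simp only [eval₂_add, eval₂_mul, eval₂_pow, eval₂_X, eval₂_C]
  simpa using h

/-- A rational root is an integer dividing 1. Modulo 3, where `n³ = n`, the value of `B n` at 1 is
`n`, and `n` times its value at `-1` is `n²`; neither vanishes when `3 ∤ n`. -/
theorem aeval_rat_B_ne_zero {n : ℤ} (h3 : ¬ (3 : ℤ) ∣ n) (q : ℚ) : aeval q (B n) ≠ 0 := by
  intro hq
  have hq' : q ^ 3 + a n * q ^ 2 + lam n * q - 1 = 0 := by simpa [B] using hq
  obtain ⟨k, rfl⟩ : ∃ k : ℤ, (k : ℚ) = q := by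
    exact IsIntegrallyClosed.isIntegral_iff.1 (isIntegral_of_cubic (p := a n) (q := lam n)
      (w := -1) (by push_cast; linarith))
  have hk : k ^ 3 + a n * k ^ 2 + lam n * k - 1 = 0 := by exact_mod_cast hq'
  have hu : k * (k ^ 2 + a n * k + lam n) = 1 := by linarith
  have hdvd : (3 : ℤ) ∣ n ^ 3 - n := by
    have : n % 3 = 0 ∨ n % 3 = 1 ∨ n % 3 = 2 := by omega
    apply Int.dvd_of_emod_eq_zero
    rcases this with h | h | h <;> simp [pow_succ, Int.sub_emod, Int.mul_emod, h]
  obtain ⟨c, hc⟩ := hdvd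
  apply h3
  rcases Int.isUnit_iff.1 (IsUnit.of_mul_eq_one _ hu) with rfl | rfl
  · have e : a n + lam n = 0 := by linarith
    rw [a_eq] at e
    simp only [lam] at e
    exact ⟨-(c * (n ^ 4 + n ^ 2 + 1 + 2 * n ^ 3) + n ^ 5 - n ^ 3 - n ^ 2 + 2 * n + 1), by
      linear_combination e - (n ^ 4 + n ^ 2 + 1 + 2 * n ^ 3) * hc⟩
  · have e : a n - lam n - 2 = 0 := by linarith
    rw [a_eq] at e
    simp only [lam] at e
    refine Int.prime_three.dvd_of_dvd_pow (n := 2) ⟨-(c * n * (n ^ 4 + n ^ 2 + 1) +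
      2 * n * c * (n ^ 3 + n) + 2 * c + n + n * (n ^ 5 - n ^ 3 - n ^ 2)), ?_⟩
    linear_combination n * e - (n * (n ^ 4 + n ^ 2 + 1) + 2 * n * (n ^ 3 + n) + 2) * hc

namespace ShanksTriple

section Ring

variable {R S : Type*} [CommRing R] [CommRing S] {n : ℤ} {y₁ y₂ y₃ : R}

theorem map_theta (φ : R →+* S) (y y' : R) : φ (theta n y y') = theta n (φ y) (φ y') := by
  simp [theta]

theorem theta_sum (h : ShanksTriple (shanksR n) (shanksS n) y₁ y₂ y₃) :
    theta n y₁ y₂ + theta n y₂ y₃ + theta n y₃ y₁ = -(a n : R) := by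
  obtain ⟨h1, h2, h3, -, -, -⟩ := h
  simp only [theta, a_eq, shanksR, shift, f, g] at *
  push_cast at *
  linear_combination (-((n : R) ^ 3 - 1 - n ^ 2)) * h1

theorem theta_sum_mul (h : ShanksTriple (shanksR n) (shanksS n) y₁ y₂ y₃) :
    theta n y₁ y₂ * theta n y₂ y₃ + theta n y₂ y₃ * theta n y₃ y₁ + theta n y₃ y₁ * theta n y₁ y₂
      = lam n := by
  obtain ⟨h1, h2, h3, -, -, -⟩ := h
  have : theta n y₁ y₂ * theta n y₂ y₃ + theta n y₂ y₃ * theta n y₃ y₁ +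
      theta n y₃ y₁ * theta n y₁ y₂ = 3 * shift n ^ 2 - 2 * shift n * (f n + g n) * shanksR n
      + (f n ^ 2 + g n ^ 2 - f n * g n) * (-((shanksR n + 3 * shanksS n) * shanksS n)) +
        f n * g n * shanksR n ^ 2 := by
    simp only [theta]
    linear_combination (-2 * (shift n : R) * (f n + g n) + f n * g n * (y₁ + y₂ + y₃ + shanksR n))
      * h1 + (f n ^ 2 + g n ^ 2 - f n * g n : R) * h2
  rw [this]
  simp only [lam, shanksR, shanksS, shift, f, g]
  push_cast
  ring

/-- The product involves the two cyclic sums `Σ yᵢ² yᵢ₊₁` and `Σ yᵢ² yᵢ₊₂`: the first is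
`sum_sq_mul`, and the second follows because their sum is symmetric. -/
theorem theta_prod (h : ShanksTriple (shanksR n) (shanksS n) y₁ y₂ y₃) :
    theta n y₁ y₂ * theta n y₂ y₃ * theta n y₃ y₁ = 1 := by
  have h4 := h.sum_sq_mul
  obtain ⟨h1, h2, h3, -, -, -⟩ := h
  have h5 : y₁ ^ 2 * y₃ + y₂ ^ 2 * y₁ + y₃ ^ 2 * y₂ =
      shanksR n * (-((shanksR n + 3 * shanksS n) * shanksS n)) - 6 * shanksS n ^ 3 := by
    linear_combination (y₁ * y₂ + y₂ * y₃ + y₃ * y₁) * h1 + (shanksR n : R) * h2 - 3 * h3 - h4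
  have : theta n y₁ y₂ * theta n y₂ y₃ * theta n y₃ y₁ = shift n ^ 3 -
      shift n ^ 2 * (f n + g n) * shanksR n + shift n * ((f n ^ 2 + g n ^ 2 - f n * g n) *
        (-((shanksR n + 3 * shanksS n) * shanksS n)) + f n * g n * shanksR n ^ 2) -
      (f n ^ 3 + g n ^ 3) * shanksS n ^ 3 - g n ^ 2 * f n * (3 * shanksS n ^ 3) -
      g n * f n ^ 2 * (shanksR n * (-((shanksR n + 3 * shanksS n) * shanksS n)) -
        6 * shanksS n ^ 3) := by
    simp only [theta]
    linear_combination (-(shift n : R) ^ 2 * (f n + g n) + shift n * f n * g n *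
      (y₁ + y₂ + y₃ + shanksR n)) * h1 + (shift n : R) * (f n ^ 2 + g n ^ 2 - f n * g n) * h2 -
      (f n ^ 3 + g n ^ 3 : R) * h3 - (g n ^ 2 * f n : R) * h4 - (g n * f n ^ 2 : R) * h5
  rw [this]
  simp only [shanksR, shanksS, shift, f, g]
  push_cast
  ring

theorem theta_root_iff [IsDomain R] [Algebra ℚ R]
    (h : ShanksTriple (shanksR n) (shanksS n) y₁ y₂ y₃) {x : R} : aeval x (B n) = 0 ↔
      x = theta n y₁ y₂ ∨ x = theta n y₂ y₃ ∨ x = theta n y₃ y₁ := by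
  have e : aeval x (B n) = (x - theta n y₁ y₂) * ((x - theta n y₂ y₃) * (x - theta n y₃ y₁)) := by
    simp only [B, map_add, map_sub, map_mul, map_pow, aeval_X, map_intCast, map_one]
    linear_combination x ^ 2 * h.theta_sum - x * h.theta_sum_mul + h.theta_prod
  rw [e, mul_eq_zero, mul_eq_zero, sub_eq_zero, sub_eq_zero, sub_eq_zero]

theorem splits_map_B {F : Type*} [Field F] [Algebra ℚ F] {y₁ y₂ y₃ : F}
    (h : ShanksTriple (shanksR n) (shanksS n) y₁ y₂ y₃) :
    ((B n).map (algebraMap ℚ F)).Splits := by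
  have : (B n).map (algebraMap ℚ F) =
      (X - C (theta n y₁ y₂)) * (X - C (theta n y₂ y₃)) * (X - C (theta n y₃ y₁)) := by
    have k1 := congrArg (C : F →+* F[X]) h.theta_sum
    have k2 := congrArg (C : F →+* F[X]) h.theta_sum_mul
    have k3 := congrArg (C : F →+* F[X]) h.theta_prod
    simp only [map_add, map_mul, map_neg, map_one] at k1 k2 k3
    simp only [B, Polynomial.map_add, Polynomial.map_sub, Polynomial.map_mul, Polynomial.map_pow,
      map_X, map_intCast, Polynomial.map_intCast, Polynomial.map_one] at *
    linear_combination X ^ 2 * k1 - X * k2 + k3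
  rw [this]
  exact ((Splits.X_sub_C _).mul (Splits.X_sub_C _)).mul (Splits.X_sub_C _)

end Ring

end ShanksTriple

theorem exists_realEmbedding (n : ℤ) (K : Type*) [Field K] [Algebra ℚ K]
    [IsSplittingField ℚ K (B n)] : Nonempty (K →ₐ[ℚ] ℝ) := by
  obtain ⟨y₁, y₂, y₃, h⟩ := exists_real_shanksTriple (shanksR n) (shanksS_ne_zero n)
  exact ⟨IsSplittingField.lift K (B n) h.splits_map_B⟩

/-- Two distinct roots of `B n` come from a simplest cubic triple. -/
theorem exists_shanksTriple {n : ℤ} {K : Type*} [Field K] [Algebra ℚ K]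
    (φ : K →ₐ[ℚ] ℝ) {θ₁ θ₂ : K} (h1 : aeval θ₁ (B n) = 0) (h2 : aeval θ₂ (B n) = 0)
    (hne : θ₁ ≠ θ₂) :
    ∃ y₁ y₂ y₃ : K, ShanksTriple (shanksR n) (shanksS n) y₁ y₂ y₃ ∧ θ₁ = theta n y₁ y₂ ∧
      (θ₂ = theta n y₂ y₃ ∨ θ₂ = theta n y₃ y₁) := by
  have hφ : Function.Injective φ := φ.toRingHom.injective
  obtain ⟨Y₁, Y₂, Y₃, hY, hY1⟩ : ∃ Y₁ Y₂ Y₃ : ℝ,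
      ShanksTriple (shanksR n) (shanksS n) Y₁ Y₂ Y₃ ∧ φ θ₁ = theta n Y₁ Y₂ := by
    obtain ⟨Y₁, Y₂, Y₃, hY⟩ := exists_real_shanksTriple (shanksR n) (shanksS_ne_zero n)
    have := hY.theta_root_iff.1 (show aeval (φ θ₁) (B n) = 0 by rw [aeval_algHom_apply, h1, map_zero])
    rcases this with h | h | h
    · exact ⟨Y₁, Y₂, Y₃, hY, h⟩
    · exact ⟨Y₂, Y₃, Y₁, hY.rotate, h⟩
    · exact ⟨Y₃, Y₁, Y₂, hY.rotate.rotate, h⟩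
  have hsum := hY.theta_sum
  -- `ω` is the root following `θ₁` in the cyclic order; `θ₂` is either `ω` or the third root.
  obtain ⟨ω, hω, hω'⟩ : ∃ ω : K, φ ω = theta n Y₂ Y₃ ∧ (θ₂ = ω ∨ θ₂ = -(a n : K) - θ₁ - ω) := by
    have := hY.theta_root_iff.1 (show aeval (φ θ₂) (B n) = 0 by rw [aeval_algHom_apply, h2, map_zero])
    rcases this with h | h | h
    · exact absurd (hφ (hY1.trans h.symm)) hne
    · exact ⟨θ₂, h, Or.inl rfl⟩
    · refine ⟨-(a n : K) - θ₁ - θ₂, ?_, Or.inr (by ring)⟩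
      simp only [map_sub, map_neg, map_intCast, hY1, h]
      linear_combination -hsum
  have hN : (f n ^ 2 - f n * g n + g n ^ 2 : ℝ) ≠ 0 := by
    exact_mod_cast f_sq_sub_mul_add_g_sq_ne_zero n
  -- Cramer's rule for `θ₁ = theta n y₁ y₂`, `ω = theta n y₂ (r - y₁ - y₂)`, a system of determinant
  -- `N`. It shows that the real `Y₁, Y₂, Y₃` already lie in the image of `K`.
  set N : K := f n ^ 2 - f n * g n + g n ^ 2 with hNdef
  set y₁ : K := ((f n - g n) * (θ₁ - shift n) + f n * (ω - shift n + f n * shanksR n)) / N with hy₁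
  set y₂ : K := -(f n * (θ₁ - shift n) + g n * (ω - shift n + f n * shanksR n)) / N with hy₂
  have e1 : φ y₁ = Y₁ := by
    simp only [hy₁, hNdef, map_div₀, map_add, map_sub, map_mul, map_pow, map_intCast, hY1, hω]
    rw [div_eq_iff hN]
    simp only [theta]
    linear_combination (-(f n : ℝ) ^ 2) * hY.sum
  have e2 : φ y₂ = Y₂ := by
    simp only [hy₂, hNdef, map_div₀, map_add, map_sub, map_mul, map_pow, map_intCast, hY1, hω,
      map_neg]
    rw [div_eq_iff hN]
    simp only [theta]
    linear_combination (f n * g n : ℝ) * hY.sum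
  have e3 : φ (shanksR n - y₁ - y₂) = Y₃ := by
    simp only [map_sub, map_intCast, e1, e2]
    linear_combination -hY.sum
  have hy : ShanksTriple (shanksR n) (shanksS n) y₁ y₂ (shanksR n - y₁ - y₂) := by
    refine ShanksTriple.of_map (φ := φ.toRingHom) hφ ?_
    change ShanksTriple _ _ (φ y₁) (φ y₂) (φ _)
    rwa [e1, e2, e3]
  have t1 : θ₁ = theta n y₁ y₂ := by
    apply hφ
    rw [hY1]
    exact (e1 ▸ e2 ▸ (ShanksTriple.map_theta φ.toRingHom y₁ y₂).symm)
  have t2 : ω = theta n y₂ (shanksR n - y₁ - y₂) := by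
    apply hφ
    rw [hω, ← e2, ← e3]
    exact (ShanksTriple.map_theta φ.toRingHom _ _).symm
  refine ⟨y₁, y₂, _, hy, t1, ?_⟩
  rcases hω' with h | h
  · left; rw [h, t2]
  · right; rw [h, t1, t2]; linear_combination -hy.theta_sum

/-! ### The cyclic Galois group -/

section Galois

variable {n : ℤ} {K : Type*} [Field K] [NumberField K] [IsSplittingField ℚ K (B n)] {y₁ y₂ y₃ : K}

theorem algEquiv_ext_of_shanksTriple (h : ShanksTriple (shanksR n) (shanksS n) y₁ y₂ y₃)
    {σ τ : K ≃ₐ[ℚ] K} (h1 : σ y₁ = τ y₁) (h2 : σ y₂ = τ y₂) (h3 : σ y₃ = τ y₃) : σ = τ := by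
  have key : (σ : K →ₐ[ℚ] K) = τ := by
    refine AlgHom.ext_of_adjoin_eq_top (IsSplittingField.adjoin_rootSet K (B n)) ?_
    intro x hx
    have hx' := aeval_eq_zero_of_mem_rootSet hx
    have hθ : ∀ (ρ : K ≃ₐ[ℚ] K) (y y' : K), ρ (theta n y y') = theta n (ρ y) (ρ y') :=
      fun ρ y y' => ShanksTriple.map_theta (ρ : K →+* K) y y'
    change σ x = τ x
    rcases h.theta_root_iff.1 hx' with rfl | rfl | rfl <;> rw [hθ, hθ] <;> simp only [h1, h2, h3]
  ext x
  exact DFunLike.congr_fun key x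

omit [IsSplittingField ℚ K (B n)] in
-- The `next` relations have rational coefficients and `s ≠ 0`, so the image of `y₁` determines the
-- other two, and only rotations occur.
theorem algEquiv_apply_eq (h : ShanksTriple (shanksR n) (shanksS n) y₁ y₂ y₃) (τ : K ≃ₐ[ℚ] K) :
    (τ y₁ = y₁ ∧ τ y₂ = y₂ ∧ τ y₃ = y₃) ∨ (τ y₁ = y₂ ∧ τ y₂ = y₃ ∧ τ y₃ = y₁) ∨
      (τ y₁ = y₃ ∧ τ y₂ = y₁ ∧ τ y₃ = y₂) := by
  have hs : (shanksS n : K) ≠ 0 := by exact_mod_cast shanksS_ne_zero n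
  have step : ∀ {p q p' q' : K}, shanksS n * q = p ^ 2 - (shanksR n + shanksS n) * p
      - 2 * shanksS n ^ 2 → shanksS n * q' = p' ^ 2 - (shanksR n + shanksS n) * p'
      - 2 * shanksS n ^ 2 → τ p = p' → τ q = q' := by
    intro p q p' q' h1 h2 h3
    apply mul_left_cancel₀ hs
    have := congrArg τ h1
    simp only [map_mul, map_sub, map_pow, map_add, map_intCast, map_ofNat, h3] at this
    rw [this, h2]
  have hroot : (τ y₁) ^ 3 - shanksR n * (τ y₁) ^ 2 -
      (shanksR n + 3 * shanksS n) * shanksS n * τ y₁ - shanksS n ^ 3 = 0 := by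
    have := congrArg τ h.root
    simpa only [map_mul, map_sub, map_pow, map_add, map_intCast, map_ofNat, map_zero] using this
  rcases h.eq_or_eq_or_eq hroot with e | e | e
  · have e2 := step h.next₁ h.next₁ e
    exact Or.inl ⟨e, e2, step h.next₂ h.next₂ e2⟩
  · have e2 := step h.next₁ h.next₂ e
    exact Or.inr (Or.inl ⟨e, e2, step h.next₂ h.next₃ e2⟩)
  · have e2 := step h.next₁ h.next₃ e
    exact Or.inr (Or.inr ⟨e, e2, step h.next₂ h.next₁ e2⟩)

theorem exists_generator (h3 : ¬ (3 : ℤ) ∣ n)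
    (h : ShanksTriple (shanksR n) (shanksS n) y₁ y₂ y₃) :
    ∃ σ : K ≃ₐ[ℚ] K, σ y₁ = y₂ ∧ σ y₂ = y₃ ∧ σ y₃ = y₁ ∧
      (∀ x, σ (σ (σ x)) = x) ∧ ∀ x, σ x = x → ∃ q : ℚ, x = q := by
  have hnormal : Normal ℚ K := Normal.of_isSplittingField (B n)
  have hgal : IsGalois ℚ K := ⟨⟩
  obtain ⟨σ, k1, k2, k3⟩ : ∃ σ : K ≃ₐ[ℚ] K, σ y₁ = y₂ ∧ σ y₂ = y₃ ∧ σ y₃ = y₁ := by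
    -- If no automorphism is the rotation, none is its inverse either, since the square of the
    -- inverse is the rotation. Then all fix the `yᵢ`, and `B n` has a rational root.
    by_contra! hcon
    have hfix : ∀ τ : K ≃ₐ[ℚ] K, τ y₁ = y₁ ∧ τ y₂ = y₂ ∧ τ y₃ = y₃ := by
      intro τ
      rcases algEquiv_apply_eq h τ with e | ⟨e1, e2, e3⟩ | ⟨e1, e2, e3⟩
      · exact e
      · exact absurd e3 (hcon τ e1 e2)
      · exact absurd (show (τ * τ) y₃ = y₁ by simp [e2, e3])
          (hcon (τ * τ) (by simp [e1, e3]) (by simp [e1, e2]))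
    have hrat : ∀ τ : K ≃ₐ[ℚ] K, τ (theta n y₁ y₂) = theta n y₁ y₂ := by
      intro τ
      have := ShanksTriple.map_theta (n := n) (τ : K →+* K) y₁ y₂
      simpa [(hfix τ).1, (hfix τ).2.1] using this
    obtain ⟨q, hq⟩ := (IsGalois.mem_range_algebraMap_iff_fixed _).2 hrat
    apply aeval_rat_B_ne_zero h3 q
    have hr : aeval (theta n y₁ y₂) (B n) = 0 := h.theta_root_iff.2 (Or.inl rfl)
    rw [← hq, aeval_algebraMap_apply] at hr
    exact (algebraMap ℚ K).injective (hr.trans (map_zero _).symm)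
  refine ⟨σ, k1, k2, k3, ?_, ?_⟩
  · intro x
    have : σ * σ * σ = 1 := algEquiv_ext_of_shanksTriple h (by simp [k1, k2, k3])
      (by simp [k1, k2, k3]) (by simp [k1, k2, k3])
    exact DFunLike.congr_fun this x
  · intro x hx
    have : x ∈ Set.range (algebraMap ℚ K) := by
      refine (IsGalois.mem_range_algebraMap_iff_fixed _).2 fun τ => ?_
      rcases algEquiv_apply_eq h τ with ⟨e1, e2, e3⟩ | ⟨e1, e2, e3⟩ | ⟨e1, e2, e3⟩
      · have : τ = 1 := algEquiv_ext_of_shanksTriple h e1 e2 e3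
        simp [this]
      · have : τ = σ := algEquiv_ext_of_shanksTriple h (by simp [*]) (by simp [*]) (by simp [*])
        simp [this, hx]
      · have : τ = σ * σ :=
          algEquiv_ext_of_shanksTriple h (by simp [*]) (by simp [*]) (by simp [*])
        simp [this, hx]
    obtain ⟨q, rfl⟩ := this
    exact ⟨q, by simp⟩

end Galois

/-! ### Units in the real embedding -/

section Units

variable {K : Type*} [Field K] [NumberField K]

/-- The action of a field automorphism on the units of the ring of integers. -/
noncomputable def unitsMap (σ : K ≃ₐ[ℚ] K) : (𝓞 K)ˣ →* (𝓞 K)ˣ :=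
  Units.map (RingOfIntegers.mapRingHom (σ : K →+* K) : 𝓞 K →* 𝓞 K)

theorem coe_unitsMap (σ : K ≃ₐ[ℚ] K) (u : (𝓞 K)ˣ) :
    ((unitsMap σ u : 𝓞 K) : K) = σ ((u : 𝓞 K) : K) := rfl

/-- The logarithm of the absolute value of a unit in a real embedding. -/
noncomputable def logAbs (φ : K →ₐ[ℚ] ℝ) : Additive (𝓞 K)ˣ →+ ℝ where
  toFun u := Real.log |φ ((u.toMul : 𝓞 K) : K)|
  map_zero' := by simp
  map_add' u v := by
    have hne : ∀ w : (𝓞 K)ˣ, |φ ((w : 𝓞 K) : K)| ≠ 0 := by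
      intro w
      rw [abs_ne_zero, _root_.map_ne_zero]
      exact RingOfIntegers.coe_ne_zero_iff.2 w.ne_zero
    rw [← Real.log_mul (hne _) (hne _), ← abs_mul, ← map_mul, ← map_mul]
    rfl

theorem logAbs_ofMul (φ : K →ₐ[ℚ] ℝ) (u : (𝓞 K)ˣ) :
    logAbs φ (.ofMul u) = Real.log |φ ((u : 𝓞 K) : K)| := rfl

variable {σ : K ≃ₐ[ℚ] K}

theorem exists_int_of_fixed (hfix : ∀ x, σ x = x → ∃ q : ℚ, x = q) (x : 𝓞 K)
    (hx : RingOfIntegers.mapRingHom (σ : K →+* K) x = x) : ∃ k : ℤ, x = k := by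
  obtain ⟨q, hq⟩ := hfix x (congrArg (fun z : 𝓞 K => (z : K)) hx)
  have hint : IsIntegral ℤ q := by
    have : IsIntegral ℤ (x : K) := x.isIntegral_coe
    rw [hq, ← eq_ratCast (algebraMap ℚ K) q] at this
    exact (isIntegral_algebraMap_iff (algebraMap ℚ K).injective).1 this
  obtain ⟨k, hk⟩ := IsIntegrallyClosed.isIntegral_iff.1 hint
  refine ⟨k, RingOfIntegers.ext ?_⟩
  rw [hq, ← hk]
  simp

theorem eq_one_or_eq_neg_one_of_fixed (hfix : ∀ x, σ x = x → ∃ q : ℚ, x = q) {u : (𝓞 K)ˣ}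
    (hu : unitsMap σ u = u) : u = 1 ∨ u = -1 := by
  have key : ∀ w : (𝓞 K)ˣ, unitsMap σ w = w → ∃ k : ℤ, (w : 𝓞 K) = k := fun w hw =>
    exists_int_of_fixed hfix w (congrArg (fun z : (𝓞 K)ˣ => (z : 𝓞 K)) hw)
  obtain ⟨k, hk⟩ := key u hu
  obtain ⟨l, hl⟩ := key u⁻¹ (by rw [map_inv, hu])
  have hkl : k * l = 1 := by
    have : (u : 𝓞 K) * (u⁻¹ : (𝓞 K)ˣ) = 1 := u.mul_inv
    rw [hk, hl] at this
    exact_mod_cast this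
  rcases Int.isUnit_iff.1 (IsUnit.of_mul_eq_one _ hkl) with rfl | rfl
  · left; ext; simp [hk]
  · right; ext; simp [hk]

theorem abs_mul_conj_eq_one (hσ : ∀ x, σ (σ (σ x)) = x) (hfix : ∀ x, σ x = x → ∃ q : ℚ, x = q)
    (φ : K →ₐ[ℚ] ℝ) (u : (𝓞 K)ˣ) :
    |φ ((u : 𝓞 K) : K) * φ (σ ((u : 𝓞 K) : K)) * φ (σ (σ ((u : 𝓞 K) : K)))| = 1 := by
  have h3 : unitsMap σ (unitsMap σ (unitsMap σ u)) = u := by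
    ext; simp only [coe_unitsMap, hσ]
  have := eq_one_or_eq_neg_one_of_fixed (σ := σ) hfix
    (u := u * unitsMap σ u * unitsMap σ (unitsMap σ u)) (by
      rw [map_mul, map_mul, h3, mul_comm, mul_assoc])
  rw [← map_mul, ← map_mul, ← coe_unitsMap, ← coe_unitsMap, ← map_mul, ← map_mul, ← Units.val_mul,
    ← Units.val_mul]
  rcases this with h | h <;> rw [h] <;> simp

theorem logAbs_add_conj (hσ : ∀ x, σ (σ (σ x)) = x) (hfix : ∀ x, σ x = x → ∃ q : ℚ, x = q)
    (φ : K →ₐ[ℚ] ℝ) (u : (𝓞 K)ˣ) : logAbs φ (.ofMul u) + logAbs φ (.ofMul (unitsMap σ u)) +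
      logAbs φ (.ofMul (unitsMap σ (unitsMap σ u))) = 0 := by
  rw [← map_add, ← map_add, ← ofMul_mul, ← ofMul_mul, logAbs_ofMul]
  change Real.log |φ ((u : 𝓞 K) * σ (u : 𝓞 K) * σ (σ (u : 𝓞 K)))| = 0
  rw [map_mul, map_mul, abs_mul_conj_eq_one hσ hfix φ u, Real.log_one]

/-- Units of small logarithmic norm are trivial. -/
theorem eq_one_or_eq_neg_one_of_logNorm_lt {r s : ℤ} {y₁ y₂ y₃ : K}
    (h : ShanksTriple r s y₁ y₂ y₃) (h₁ : σ y₁ = y₂) (h₂ : σ y₂ = y₃) (h₃ : σ y₃ = y₁)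
    (hσ : ∀ x, σ (σ (σ x)) = x) (hfix : ∀ x, σ x = x → ∃ q : ℚ, x = q) (φ : K →ₐ[ℚ] ℝ)
    (hsf : Squarefree (r ^ 2 + 3 * r * s + 9 * s ^ 2))
    (h3m : IsCoprime (r ^ 2 + 3 * r * s + 9 * s ^ 2) 3) (hm : 2 ≤ r ^ 2 + 3 * r * s + 9 * s ^ 2)
    (u : (𝓞 K)ˣ) (hu : logNorm (unitsMap σ) (logAbs φ) u <
      Real.log (((r ^ 2 + 3 * r * s + 9 * s ^ 2 : ℤ) : ℝ) / 2) ^ 2 / 4) : u = 1 ∨ u = -1 := by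
  have hint : ∀ {z₁ z₂ z₃ : K}, ShanksTriple r s z₁ z₂ z₃ → IsIntegral ℤ z₁ := by
    intro z₁ z₂ z₃ hz
    refine isIntegral_of_cubic (p := -r) (q := -((r + 3 * s) * s)) (w := -s ^ 3) ?_
    have := hz.root
    push_cast
    linear_combination this
  have hO : ShanksTriple r s (⟨y₁, hint h⟩ : 𝓞 K) ⟨y₂, hint h.rotate⟩ ⟨y₃, hint h.rotate.rotate⟩ :=
    ShanksTriple.of_map (φ := algebraMap (𝓞 K) K) RingOfIntegers.coe_injective h
  obtain ⟨k, hk⟩ := hO.dvd_prod_sub (σ := RingOfIntegers.mapRingHom (σ : K →+* K))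
    (exists_int_of_fixed hfix) (RingOfIntegers.ext h₁) (RingOfIntegers.ext h₂)
    (RingOfIntegers.ext h₃) hsf h3m (ε := (u : 𝓞 K)) (RingOfIntegers.ext (hσ _))
  have hk' : ((u : 𝓞 K) - σ (u : 𝓞 K) : K) * (σ (u : 𝓞 K) - σ (σ (u : 𝓞 K))) *
      (σ (σ (u : 𝓞 K)) - (u : 𝓞 K)) = (((r ^ 2 + 3 * r * s + 9 * s ^ 2) * k : ℤ) : K) := by
    have := congrArg (algebraMap (𝓞 K) K) hk
    rw [map_intCast] at this
    exact this
  -- For `k = 0` two conjugates coincide and `u` is rational; otherwise the product of differences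
  -- is at least `m` in absolute value.
  by_cases hk0 : k = 0
  · rw [hk0, mul_zero, Int.cast_zero, mul_eq_zero, mul_eq_zero] at hk'
    apply eq_one_or_eq_neg_one_of_fixed hfix
    ext
    rw [coe_unitsMap]
    rcases hk' with (e | e) | e
    · exact (sub_eq_zero.1 e).symm
    · exact (σ.injective (sub_eq_zero.1 e)).symm
    · have := congrArg σ (sub_eq_zero.1 e)
      rw [hσ] at this
      exact this.symm
  · exfalso
    simp only [logNorm, logAbs_ofMul, coe_unitsMap] at hu
    apply hu.not_ge
    refine sq_log_le_of_le_abs_prod_sub (abs_mul_conj_eq_one hσ hfix φ u) (by exact_mod_cast hm) ?_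
    have e := congrArg φ hk'
    simp only [map_mul, map_sub, map_intCast] at e
    rw [e, ← Int.cast_abs, abs_mul, abs_of_nonneg (by linarith)]
    have : (1 : ℤ) ≤ |k| := Int.one_le_abs hk0
    exact_mod_cast (by nlinarith : r ^ 2 + 3 * r * s + 9 * s ^ 2 ≤
      (r ^ 2 + 3 * r * s + 9 * s ^ 2) * |k|)

end Units

/-! ### The roots generate the unit group -/

theorem isCoprime_three {n : ℤ} (h3 : ¬ (3 : ℤ) ∣ n) : IsCoprime (3 * a n + lam n ^ 2) 3 := by
  refine ((Int.prime_three.coprime_iff_not_dvd).2 fun h => h3 ?_).symm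
  have h1 : (3 : ℤ) ∣ lam n := Int.prime_three.dvd_of_dvd_pow
    ((Int.dvd_add_right (dvd_mul_right 3 (a n))).1 h)
  refine Int.prime_three.dvd_of_dvd_pow (n := 4) ?_
  rw [show n ^ 4 = 3 * n - lam n by simp only [lam]; ring]
  exact dvd_sub (dvd_mul_right 3 n) h1

theorem three_le_of_squarefree {n : ℤ} (hn : n ≠ -1)
    (hsf : Squarefree (3 * a n + lam n ^ 2)) : 3 ≤ 3 * a n + lam n ^ 2 := by
  rw [three_a_add_lam_sq]
  rcases cases_of_squarefree hn hsf with rfl | rfl | h | h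
  · norm_num
  · norm_num
  · obtain ⟨k, hk, rfl⟩ : ∃ k : ℤ, 0 ≤ k ∧ n = 4 + k := ⟨n - 4, by omega, by ring⟩
    rw [← sub_nonneg]; ring_nf; positivity
  · obtain ⟨k, hk, rfl⟩ : ∃ k : ℤ, 0 ≤ k ∧ n = -4 - k := ⟨-4 - n, by omega, by ring⟩
    rw [← sub_nonneg]; ring_nf; positivity

theorem closure_le_of_mul_eq_one {G : Type*} [CommGroup G] [HasDistribNeg G] {u v w : G}
    (h : u * v * w = 1) : Subgroup.closure {-1, u, v} ≤ Subgroup.closure {-1, u, w} := by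
  have h1 : (-1 : G) ∈ Subgroup.closure {-1, u, w} := Subgroup.subset_closure (by simp)
  have h2 : u ∈ Subgroup.closure {-1, u, w} := Subgroup.subset_closure (by simp)
  have h3 : w ∈ Subgroup.closure {-1, u, w} := Subgroup.subset_closure (by simp)
  rw [Subgroup.closure_le]
  rintro x (rfl | rfl | rfl)
  · exact h1
  · exact h2
  · rw [show x = u⁻¹ * w⁻¹ by rw [← mul_inv, eq_inv_iff_mul_eq_one, ← h]; ac_rfl]
    exact mul_mem (inv_mem h2) (inv_mem h3)

/-- Allows `θ₂` to be either conjugate of `θ₁`, the three roots having product 1. -/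
theorem closure_eq_of_mul_eq_one {G : Type*} [CommGroup G] [HasDistribNeg G] {u v w : G}
    (h : u * v * w = 1) : Subgroup.closure {-1, u, w} = Subgroup.closure {-1, u, v} :=
  le_antisymm (closure_le_of_mul_eq_one (by rw [← h]; ac_rfl)) (closure_le_of_mul_eq_one h)

/-- The arithmetic data attached to two roots of `B n`: the real embedding, the Galois group, and
the roots as units. -/
theorem exists_unit_data {n : ℤ} (h3 : ¬ (3 : ℤ) ∣ n) {K : Type*} [Field K] [NumberField K]
    [IsSplittingField ℚ K (B n)] {θ₁ θ₂ : K} (h1 : aeval θ₁ (B n) = 0) (h2 : aeval θ₂ (B n) = 0)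
    (hne : θ₁ ≠ θ₂) :
    ∃ (σ : K ≃ₐ[ℚ] K) (y₁ y₂ y₃ : K) (u : (𝓞 K)ˣ),
      ShanksTriple (shanksR n) (shanksS n) y₁ y₂ y₃ ∧ σ y₁ = y₂ ∧ σ y₂ = y₃ ∧ σ y₃ = y₁ ∧
      (∀ x, σ (σ (σ x)) = x) ∧ (∀ x, σ x = x → ∃ q : ℚ, x = q) ∧
      ((u : 𝓞 K) : K) = θ₁ ∧ ((u : 𝓞 K) : K) = theta n y₁ y₂ ∧
      u * unitsMap σ u * unitsMap σ (unitsMap σ u) = 1 ∧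
      (θ₂ = ((unitsMap σ u : 𝓞 K) : K) ∨ θ₂ = ((unitsMap σ (unitsMap σ u) : 𝓞 K) : K)) := by
  obtain ⟨φ⟩ := exists_realEmbedding n K
  obtain ⟨y₁, y₂, y₃, h, rfl, hθ⟩ := exists_shanksTriple φ h1 h2 hne
  obtain ⟨σ, k1, k2, k3, hσ, hfix⟩ := exists_generator h3 h
  have hint : ∀ x : K, aeval x (B n) = 0 → IsIntegral ℤ x := by
    intro x hx
    refine isIntegral_of_cubic (p := a n) (q := lam n) (w := -1) ?_
    simp only [B, map_add, map_sub, map_mul, map_pow, aeval_X, map_intCast, map_one] at hx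
    push_cast
    linear_combination hx
  have i1 := hint _ h1
  have i2 := hint _ (h.theta_root_iff.2 (Or.inr (Or.inl rfl)))
  have i3 := hint _ (h.theta_root_iff.2 (Or.inr (Or.inr rfl)))
  have hmap : ∀ y y' : K, σ (theta n y y') = theta n (σ y) (σ y') :=
    fun y y' => ShanksTriple.map_theta (σ : K →+* K) y y'
  have hprod : (⟨_, i1⟩ : 𝓞 K) * (⟨_, i2⟩ * ⟨_, i3⟩) = 1 := by
    apply RingOfIntegers.ext
    rw [← mul_assoc]
    exact h.theta_prod
  have t1 : σ (theta n y₁ y₂) = theta n y₂ y₃ := by rw [hmap, k1, k2]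
  have t2 : σ (theta n y₂ y₃) = theta n y₃ y₁ := by rw [hmap, k2, k3]
  refine ⟨σ, y₁, y₂, y₃, Units.mkOfMulEqOne _ _ hprod, h, k1, k2, k3, hσ, hfix, rfl, rfl, ?_, ?_⟩
  · ext
    change theta n y₁ y₂ * σ (theta n y₁ y₂) * σ (σ (theta n y₁ y₂)) = 1
    rw [t1, t2, h.theta_prod]
  · change θ₂ = σ (theta n y₁ y₂) ∨ θ₂ = σ (σ (theta n y₁ y₂))
    rwa [t1, t2]

/-- A size below `c` forces `u = ±1`, and `B n` has no rational root. -/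
theorem logNorm_pos_of_root {n : ℤ} (h3 : ¬ (3 : ℤ) ∣ n) {K : Type*} [Field K] [NumberField K]
    {σ : K ≃ₐ[ℚ] K} {φ : K →ₐ[ℚ] ℝ} {c : ℝ} (hc0 : 0 < c)
    (hc : ∀ u, logNorm (unitsMap σ) (logAbs φ) u < c → u = 1 ∨ u = -1) {u : (𝓞 K)ˣ}
    (hu : aeval ((u : 𝓞 K) : K) (B n) = 0) : 0 < logNorm (unitsMap σ) (logAbs φ) u := by
  by_contra! hle
  have key : ∀ q : ℚ, ((u : 𝓞 K) : K) ≠ algebraMap ℚ K q := by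
    intro q hq
    rw [hq, aeval_algebraMap_apply] at hu
    exact aeval_rat_B_ne_zero h3 q ((algebraMap ℚ K).injective (hu.trans (map_zero _).symm))
  rcases hc u (hle.trans_lt hc0) with h | h
  · exact key 1 (by simp [h])
  · exact key (-1) (by simp [h])

theorem closure_roots_eq_top {n : ℤ} (hn : n ≠ -1) (hsf : Squarefree (3 * a n + lam n ^ 2))
    (K : Type*) [Field K] [NumberField K] [IsSplittingField ℚ K (B n)] (θ₁ θ₂ : K)
    (h1 : aeval θ₁ (B n) = 0) (h2 : aeval θ₂ (B n) = 0) (hne : θ₁ ≠ θ₂) :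
    ∃ u₁ u₂ : (𝓞 K)ˣ, ((u₁ : 𝓞 K) : K) = θ₁ ∧ ((u₂ : 𝓞 K) : K) = θ₂ ∧
      Subgroup.closure {-1, u₁, u₂} = (⊤ : Subgroup (𝓞 K)ˣ) := by
  have h3 := not_three_dvd_of_squarefree hsf
  obtain ⟨φ⟩ := exists_realEmbedding n K
  obtain ⟨σ, y₁, y₂, y₃, u, h, k1, k2, k3, hσ, hfix, hu, hu', hprod, hθ⟩ :=
    exists_unit_data h3 h1 h2 hne
  have hm := three_le_of_squarefree hn hsf
  have hcop := isCoprime_three h3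
  have hlog : logNorm (unitsMap σ) (logAbs φ) u <
      3 * (Real.log (((3 * a n + lam n ^ 2 : ℤ) : ℝ) / 2) ^ 2 / 4) := by
    have hmap : ∀ y y' : K, σ (theta n y y') = theta n (σ y) (σ y') :=
      fun y y' => ShanksTriple.map_theta (σ : K →+* K) y y'
    have e1 := congrArg φ h.theta_sum
    have e2 := congrArg φ h.theta_sum_mul
    have e3 := congrArg φ h.theta_prod
    simp only [map_add, map_mul, map_neg, map_intCast, map_one] at e1 e2 e3
    have := log_form_lt_of_squarefree hn hsf e1 e2 e3
    simpa only [logNorm, logAbs_ofMul, coe_unitsMap, hu', hmap, k1, k2] using this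
  have hc0 : 0 < Real.log (((3 * a n + lam n ^ 2 : ℤ) : ℝ) / 2) ^ 2 / 4 := by
    have : (3 : ℝ) ≤ ((3 * a n + lam n ^ 2 : ℤ) : ℝ) := by exact_mod_cast hm
    have := Real.log_pos (show 1 < ((3 * a n + lam n ^ 2 : ℤ) : ℝ) / 2 by linarith)
    positivity
  have hc : ∀ v, logNorm (unitsMap σ) (logAbs φ) v <
      Real.log (((3 * a n + lam n ^ 2 : ℤ) : ℝ) / 2) ^ 2 / 4 → v = 1 ∨ v = -1 := by
    rw [three_a_add_lam_sq_eq] at hsf hcop hm ⊢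
    exact eq_one_or_eq_neg_one_of_logNorm_lt h k1 k2 k3 hσ hfix φ hsf hcop (by linarith)
  have htop := closure_eq_top_of_logNorm_lt (logAbs_add_conj hσ hfix φ) hc
    (logNorm_pos_of_root h3 hc0 hc (hu ▸ h1)) hlog
  rcases hθ with e | e
  · exact ⟨u, unitsMap σ u, hu, e.symm, htop⟩
  · exact ⟨u, unitsMap σ (unitsMap σ u), hu, e.symm, by rw [closure_eq_of_mul_eq_one hprod, htop]⟩

/-! ### The exceptional parameter `n = -1` -/

/-- Two of the three numbers have the same sign; the form is the square of the third minus their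
product. -/
theorem sq_add_mul_add_sq_le {X Y Z H : ℝ} (h : X + Y + Z = 0) (hX : |X| ≤ H) (hY : |Y| ≤ H)
    (hZ : |Z| ≤ H) : X ^ 2 + X * Y + Y ^ 2 ≤ H ^ 2 := by
  have hX2 : X ^ 2 ≤ H ^ 2 := sq_le_sq' (abs_le.1 hX).1 (abs_le.1 hX).2
  have hY2 : Y ^ 2 ≤ H ^ 2 := sq_le_sq' (abs_le.1 hY).1 (abs_le.1 hY).2
  have hZ2 : Z ^ 2 ≤ H ^ 2 := sq_le_sq' (abs_le.1 hZ).1 (abs_le.1 hZ).2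
  obtain rfl : Z = -X - Y := by linarith
  rcases le_total 0 X with hx | hx <;> rcases le_total 0 Y with hy | hy
  · nlinarith [mul_nonneg hx hy]
  · rcases le_total 0 (X + Y) with hz | hz
    · nlinarith [mul_nonneg (neg_nonneg.2 hy) hz]
    · nlinarith [mul_nonneg hx (neg_nonneg.2 hz)]
  · rcases le_total 0 (X + Y) with hz | hz
    · nlinarith [mul_nonneg (neg_nonneg.2 hx) hz]
    · nlinarith [mul_nonneg hy (neg_nonneg.2 hz)]
  · nlinarith [mul_nonneg (neg_nonneg.2 hx) (neg_nonneg.2 hy)]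

/-- The logarithmic size of the roots of `Y³ + 2 Y² - Y - 1`. -/
theorem abs_log_root_le {y : ℝ} (h : y ^ 3 + 2 * y ^ 2 - y - 1 = 0) :
    |(Real.log (|y|))| ≤ 6 / 7 * Real.log (7 / 2) := by
  have hy : y ≠ 0 := by rintro rfl; norm_num at h
  have hyp : 0 < |y| := abs_pos.2 hy
  have hup : |y| ≤ 29 / 10 := by
    by_contra! hlt
    have h1 : |y| ^ 3 ≤ 2 * |y| ^ 2 + |y| + 1 := by
      rw [← abs_pow, show y ^ 3 = -(2 * y ^ 2) + (y + 1) by linarith]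
      refine (abs_add_le _ _).trans ?_
      rw [abs_neg, abs_mul, abs_two, abs_pow]
      have := abs_add_le y 1
      rw [abs_one] at this
      linarith
    nlinarith
  have hlow : 10 / 29 ≤ |y| := by
    by_contra! hlt
    have h1 : (1 : ℝ) ≤ |y| ^ 3 + 2 * |y| ^ 2 + |y| := by
      have : |(1 : ℝ)| = |y ^ 3 + 2 * y ^ 2 + -y| := by congr 1; linarith
      rw [abs_one] at this
      rw [this]
      refine (abs_add_le _ _).trans ?_
      rw [abs_neg]
      gcongr
      refine (abs_add_le _ _).trans ?_
      rw [abs_mul, abs_two, abs_pow, abs_pow]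
    have h2 : |y| ^ 2 ≤ (10 / 29) ^ 2 := pow_le_pow_left₀ hyp.le hlt.le 2
    have h3 : |y| ^ 3 ≤ (10 / 29) ^ 3 := pow_le_pow_left₀ hyp.le hlt.le 3
    linarith
  -- The factor `6/7` is chosen because `(6/7)² = 36/49 < 3/4`, which is what the bound `3c` with `m
  -- = 7` requires.
  have hlog : Real.log (29 / 10) ≤ 6 / 7 * Real.log (7 / 2) := by
    have : Real.log ((29 / 10) ^ 7) ≤ Real.log ((7 / 2) ^ 6) :=
      Real.log_le_log (by norm_num) (by norm_num)
    rw [Real.log_pow, Real.log_pow] at this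
    push_cast at this
    linarith
  rw [abs_le]
  constructor
  · have : Real.log (10 / 29) ≤ Real.log |y| := Real.log_le_log (by norm_num) hlow
    rw [show (10 / 29 : ℝ) = (29 / 10)⁻¹ by norm_num, Real.log_inv] at this
    linarith
  · exact (Real.log_le_log hyp hup).trans hlog

section Index

variable {G : Type*} [CommGroup G] [HasDistribNeg G] {σ : G →* G} {x : Additive G →+ ℝ}

/-- The integer is the Eisenstein norm `a² - ab + b²` of the exponents. It is used to show that an
element of too small a size lies outside the subgroup. -/
theorem exists_logNorm_eq_of_mem_closure
    (hx : ∀ u, x (.ofMul u) + x (.ofMul (σ u)) + x (.ofMul (σ (σ u))) = 0) (hneg : σ (-1) = -1)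
    {u w : G} (hw : w ∈ Subgroup.closure {-1, u, σ u}) :
    ∃ k : ℤ, logNorm σ x w = logNorm σ x u * k := by
  have hx1 : x (.ofMul (-1)) = 0 := by
    have : x (.ofMul ((-1) * (-1))) = 0 := by rw [neg_one_mul, neg_neg, ofMul_one, map_zero]
    rw [ofMul_mul, map_add] at this
    linarith
  have key : ∃ a b : ℤ, x (.ofMul w) = a * x (.ofMul u) + b * x (.ofMul (σ u)) ∧
      x (.ofMul (σ w)) = a * x (.ofMul (σ u)) + b * x (.ofMul (σ (σ u))) := by
    induction hw using Subgroup.closure_induction with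
    | mem v hv =>
      rcases hv with rfl | rfl | rfl
      · exact ⟨0, 0, by simp [hx1], by simp [hneg, hx1]⟩
      · exact ⟨1, 0, by simp, by simp⟩
      · exact ⟨0, 1, by simp, by simp⟩
    | one => exact ⟨0, 0, by simp, by simp⟩
    | mul v w _ _ hv hw =>
      obtain ⟨a, b, h1, h2⟩ := hv
      obtain ⟨c, d, h3, h4⟩ := hw
      refine ⟨a + c, b + d, ?_, ?_⟩
      · rw [ofMul_mul, map_add, h1, h3]; push_cast; ring
      · rw [map_mul, ofMul_mul, map_add, h2, h4]; push_cast; ring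
    | inv v _ hv =>
      obtain ⟨a, b, h1, h2⟩ := hv
      refine ⟨-a, -b, ?_, ?_⟩
      · rw [ofMul_inv, map_neg, h1]; push_cast; ring
      · rw [map_inv, ofMul_inv, map_neg, h2]; push_cast; ring
  obtain ⟨a, b, h1, h2⟩ := key
  refine ⟨a ^ 2 - a * b + b ^ 2, ?_⟩
  have h' : x (.ofMul (σ (σ u))) = -x (.ofMul u) - x (.ofMul (σ u)) := by linarith [hx u]
  simp only [logNorm, h1, h2, h']
  push_cast
  ring

/-- The subgroup generated by the quotients of the conjugates of a generator has index three. -/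
theorem index_closure_eq_three
    (hx : ∀ u, x (.ofMul u) + x (.ofMul (σ u)) + x (.ofMul (σ (σ u))) = 0) (hneg : σ (-1) = -1)
    {c : ℝ} (hc : ∀ u, logNorm σ x u < c → u = 1 ∨ u = -1) {v : G}
    (hv : 0 < logNorm σ x v) (hvc : logNorm σ x v < 3 * c) (hprod : v * σ v * σ (σ v) = 1)
    {u : G} (hu : u * σ v = σ (σ v)) :
    (Subgroup.closure {-1, u, σ u}).index = 3 := by
  have hσ3 : σ (σ (σ v)) = v := by
    have := congrArg σ hprod
    rw [map_mul, map_mul, map_one, ← hprod] at this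
    rw [mul_comm, ← mul_assoc] at this
    exact mul_right_cancel (mul_right_cancel this)
  have hu' : σ u * σ (σ v) = v := by rw [← map_mul, hu, hσ3]
  set H := Subgroup.closure {-1, u, σ u} with hH
  have m1 : (-1 : G) ∈ H := Subgroup.subset_closure (by simp)
  have m2 : u ∈ H := Subgroup.subset_closure (by simp)
  have m3 : σ u ∈ H := Subgroup.subset_closure (by simp)
  have hcube : v ^ 3 = u * σ u ^ 2 := by
    have e : u * σ u ^ 2 * (v * σ v * σ (σ v)) = v ^ 3 := by
      calc u * σ u ^ 2 * (v * σ v * σ (σ v)) = (u * σ v) * (σ u * σ (σ v)) * σ u * v := by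
            rw [sq]; ac_rfl
        _ = (σ u * σ (σ v)) * v * v := by rw [hu]; nth_rewrite 1 [hu']; ac_rfl
        _ = v ^ 3 := by rw [hu', pow_succ, sq]
    rw [← e, hprod, mul_one]
  have hvσ : σ v * (u * σ u) = v := by
    calc σ v * (u * σ u) = (u * σ v) * σ u := by ac_rfl
      _ = v := by rw [hu, mul_comm, hu']
  -- `u = σ²v / σv` has three times the size of `v`, whereas membership would make the size of `v`
  -- an integral multiple of that of `u`.
  have hnot : v ∉ H := by
    intro hmem
    obtain ⟨k, hk⟩ := exists_logNorm_eq_of_mem_closure hx hneg hmem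
    have h3 : logNorm σ x u = 3 * logNorm σ x v := by
      have e1 : x (.ofMul u) = x (.ofMul (σ (σ v))) - x (.ofMul (σ v)) := by
        rw [← hu, ofMul_mul, map_add]; ring
      have e2 : x (.ofMul (σ u)) = x (.ofMul v) - x (.ofMul (σ (σ v))) := by
        rw [← hu', ofMul_mul, map_add, hu']; ring
      have h' : x (.ofMul (σ (σ v))) = -x (.ofMul v) - x (.ofMul (σ v)) := by linarith [hx v]
      simp only [logNorm, e1, e2, h']
      ring
    rw [h3] at hk
    have : (3 * k : ℝ) = 1 := by
      apply mul_left_cancel₀ hv.ne'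
      linarith
    have : 3 * k = 1 := by exact_mod_cast this
    omega
  have hq3 : (QuotientGroup.mk v : G ⧸ H) ^ 3 = 1 := by
    rw [← QuotientGroup.mk_pow, QuotientGroup.eq_one_iff, hcube]
    exact mul_mem m2 (pow_mem m3 2)
  have hq1 : (QuotientGroup.mk v : G ⧸ H) ≠ 1 := by
    rwa [Ne, QuotientGroup.eq_one_iff]
  -- Since `v` and `σ v` generate up to sign, the quotient is cyclic on the class of `v`, whose cube
  -- is trivial.
  have hqσ : (QuotientGroup.mk (σ v) : G ⧸ H) = QuotientGroup.mk v := by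
    rw [QuotientGroup.eq, inv_mul_eq_iff_eq_mul.2 hvσ.symm]
    exact mul_mem m2 m3
  have htop : Subgroup.zpowers (QuotientGroup.mk v : G ⧸ H) = ⊤ := by
    rw [eq_top_iff]
    rintro q -
    obtain ⟨w, rfl⟩ := QuotientGroup.mk_surjective q
    obtain ⟨a, b, h⟩ := exists_eq_zpow_mul_zpow hx hc hv hvc w
    have hw : (QuotientGroup.mk w : G ⧸ H) = QuotientGroup.mk (v ^ a * σ v ^ b) := by
      rcases h with h | h
      · rw [h]
      · rw [QuotientGroup.eq, h, inv_neg, neg_mul, inv_mul_cancel]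
        exact m1
    rw [hw, QuotientGroup.mk_mul, QuotientGroup.mk_zpow, QuotientGroup.mk_zpow, hqσ, ← zpow_add]
    exact Subgroup.zpow_mem_zpowers _ _
  rw [Subgroup.index_eq_card, ← Subgroup.card_top, ← htop, Nat.card_zpowers]
  exact orderOf_eq_prime hq3 hq1

end Index

theorem three_a_add_lam_sq_neg_one : 3 * a (-1) + lam (-1) ^ 2 = 7 := by
  rw [three_a_add_lam_sq]; norm_num

theorem index_closure_roots_neg_one (K : Type*) [Field K] [NumberField K]
    [IsSplittingField ℚ K (B (-1))] (θ₁ θ₂ : K) (h1 : aeval θ₁ (B (-1)) = 0)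
    (h2 : aeval θ₂ (B (-1)) = 0) (hne : θ₁ ≠ θ₂) :
    ∃ u₁ u₂ : (𝓞 K)ˣ, ((u₁ : 𝓞 K) : K) = θ₁ ∧ ((u₂ : 𝓞 K) : K) = θ₂ ∧
      (Subgroup.closure {-1, u₁, u₂} : Subgroup (𝓞 K)ˣ).index = 3 := by
  have h3 : ¬ (3 : ℤ) ∣ -1 := by decide
  obtain ⟨φ⟩ := exists_realEmbedding (-1) K
  obtain ⟨σ, y₁, y₂, y₃, u, h, k1, k2, k3, hσ, hfix, hu, hu', hprod, hθ⟩ :=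
    exists_unit_data h3 h1 h2 hne
  have hR : shanksR (-1) = -2 := by norm_num [shanksR]
  have hS : shanksS (-1) = 1 := by norm_num [shanksS]
  rw [hR, hS] at h
  have hroot : ∀ {z₁ z₂ z₃ : K}, ShanksTriple (-2) 1 z₁ z₂ z₃ →
      z₁ ^ 3 + 2 * z₁ ^ 2 - z₁ - 1 = 0 := by
    intro z₁ z₂ z₃ hz
    have := hz.root
    push_cast at this
    linear_combination this
  have hint : ∀ {z₁ z₂ z₃ : K}, ShanksTriple (-2) 1 z₁ z₂ z₃ → IsIntegral ℤ z₁ := by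
    intro z₁ z₂ z₃ hz
    refine isIntegral_of_cubic (p := 2) (q := -1) (w := -1) ?_
    push_cast
    linear_combination hroot hz
  have hy : y₁ * y₂ * y₃ = 1 := by simpa using h.prod
  have hprodO : (⟨y₁, hint h⟩ : 𝓞 K) * (⟨y₂, hint h.rotate⟩ * ⟨y₃, hint h.rotate.rotate⟩) = 1 := by
    apply RingOfIntegers.ext
    rw [← mul_assoc]
    exact hy
  set v : (𝓞 K)ˣ := Units.mkOfMulEqOne _ _ hprodO
  have v1 : ((v : 𝓞 K) : K) = y₁ := rfl
  have v2 : ((unitsMap σ v : 𝓞 K) : K) = y₂ := k1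
  have v3 : ((unitsMap σ (unitsMap σ v) : 𝓞 K) : K) = y₃ := by rw [coe_unitsMap, v2, k2]
  have hvprod : v * unitsMap σ v * unitsMap σ (unitsMap σ v) = 1 := by
    ext
    change ((v : 𝓞 K) : K) * ((unitsMap σ v : 𝓞 K) : K) *
      ((unitsMap σ (unitsMap σ v) : 𝓞 K) : K) = 1
    rw [v1, v2, v3, hy]
  -- For `n = -1` the root is `3 + 2 y₁ + y₂`, which equals `y₃ / y₂`.
  have huv : u * unitsMap σ v = unitsMap σ (unitsMap σ v) := by
    ext
    change ((u : 𝓞 K) : K) * ((unitsMap σ v : 𝓞 K) : K) = ((unitsMap σ (unitsMap σ v) : 𝓞 K) : K)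
    rw [hu', v2, v3]
    obtain ⟨s1, s2, s3, s4, s5, s6⟩ := h
    simp only [theta, shift, f, g]
    push_cast at *
    grind
  have hsf : Squarefree (3 * a (-1) + lam (-1) ^ 2) := by
    rw [three_a_add_lam_sq_neg_one]
    exact (Int.prime_iff_natAbs_prime.2 (by norm_num)).squarefree
  have hc : ∀ w, logNorm (unitsMap σ) (logAbs φ) w < Real.log (7 / 2) ^ 2 / 4 →
      w = 1 ∨ w = -1 := by
    have := eq_one_or_eq_neg_one_of_logNorm_lt h k1 k2 k3 hσ hfix φ
      (by rw [three_a_add_lam_sq_eq, hR, hS] at hsf; exact hsf)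
      (by have := isCoprime_three h3; rw [three_a_add_lam_sq_eq, hR, hS] at this; exact this)
      (by norm_num)
    norm_num at this ⊢
    exact this
  have hlogpos : 0 < Real.log (7 / 2) := Real.log_pos (by norm_num)
  have hx := logAbs_add_conj hσ hfix φ
  have hsize : logNorm (unitsMap σ) (logAbs φ) v < 3 * (Real.log (7 / 2) ^ 2 / 4) := by
    have hb : ∀ {z₁ z₂ z₃ : K}, ShanksTriple (-2) 1 z₁ z₂ z₃ →
        |(Real.log (|φ z₁|))| ≤ 6 / 7 * Real.log (7 / 2) := by
      intro z₁ z₂ z₃ hz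
      apply abs_log_root_le
      have := congrArg φ (hroot hz)
      simpa only [map_add, map_sub, map_mul, map_pow, map_ofNat, map_one, map_zero] using this
    have := sq_add_mul_add_sq_le (hx v) (H := 6 / 7 * Real.log (7 / 2))
      (by rw [logAbs_ofMul, v1]; exact hb h) (by rw [logAbs_ofMul, v2]; exact hb h.rotate)
      (by rw [logAbs_ofMul, v3]; exact hb h.rotate.rotate)
    have e : logNorm (unitsMap σ) (logAbs φ) v ≤ (6 / 7 * Real.log (7 / 2)) ^ 2 := this
    nlinarith [mul_pos hlogpos hlogpos]
  have hvpos : 0 < logNorm (unitsMap σ) (logAbs φ) v := by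
    by_contra! hle
    -- If `q² = 1`, then `q³ + 2q² - q - 1 = 1 ≠ 0`.
    have key : ∀ q : K, q ^ 2 = 1 → y₁ ≠ q := by
      rintro q hq rfl
      have e := hroot h
      grind
    rcases hc v (hle.trans_lt (by positivity)) with e | e
    · exact key 1 (by norm_num) (by rw [← v1, e]; simp)
    · exact key (-1) (by norm_num) (by rw [← v1, e]; simp)
  have hneg : unitsMap σ (-1) = -1 := by
    ext
    rw [coe_unitsMap]
    simp
  have hidx := index_closure_eq_three hx hneg hc hvpos hsize hvprod huv
  rcases hθ with e | e
  · exact ⟨u, unitsMap σ u, hu, e.symm, hidx⟩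
  · exact ⟨u, unitsMap σ (unitsMap σ u), hu, e.symm, by rw [closure_eq_of_mul_eq_one hprod, hidx]⟩

end UnitFamily

theorem mainTheorem4 :
    (∀ n : ℤ, n ≠ -1 → Squarefree (3 * UnitFamily.a n + UnitFamily.lam n ^ 2) →
      ∀ (K : Type*) [Field K] [NumberField K] [IsSplittingField ℚ K (UnitFamily.B n)]
        (θ₁ θ₂ : K), aeval θ₁ (UnitFamily.B n) = 0 → aeval θ₂ (UnitFamily.B n) = 0 → θ₁ ≠ θ₂ →
        ∃ u₁ u₂ : (𝓞 K)ˣ, ((u₁ : 𝓞 K) : K) = θ₁ ∧ ((u₂ : 𝓞 K) : K) = θ₂ ∧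
          Subgroup.closure {-1, u₁, u₂} = (⊤ : Subgroup (𝓞 K)ˣ)) ∧
    (Squarefree (3 * UnitFamily.a (-1) + UnitFamily.lam (-1) ^ 2) ∧
      ∀ (K : Type*) [Field K] [NumberField K] [IsSplittingField ℚ K (UnitFamily.B (-1))]
        (θ₁ θ₂ : K), aeval θ₁ (UnitFamily.B (-1)) = 0 → aeval θ₂ (UnitFamily.B (-1)) = 0 →
        θ₁ ≠ θ₂ →
        ∃ u₁ u₂ : (𝓞 K)ˣ, ((u₁ : 𝓞 K) : K) = θ₁ ∧ ((u₂ : 𝓞 K) : K) = θ₂ ∧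
          (Subgroup.closure {-1, u₁, u₂} : Subgroup (𝓞 K)ˣ).index = 3) := by
  refine ⟨fun n hn hsf K _ _ _ θ₁ θ₂ h1 h2 hne =>
    UnitFamily.closure_roots_eq_top hn hsf K θ₁ θ₂ h1 h2 hne, ?_, fun K _ _ _ θ₁ θ₂ h1 h2 hne =>
    UnitFamily.index_closure_roots_neg_one K θ₁ θ₂ h1 h2 hne⟩
  rw [UnitFamily.three_a_add_lam_sq_neg_one]
  exact (Int.prime_iff_natAbs_prime.2 (by norm_num)).squarefree
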